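/- Let $\lambda,\mu,\nu>0$ and $\varepsilon\in[0,1]$. In the classical Cramér–Lundberg risk model, premiums come in at rate $1$, claims arrive according to a Poisson process $N$ with rate $\lambda$, and the claim sizes $U_1,U_2,\dots$ are nonnegative, i.i.d. and independent of $N$. The ruin probability with initial capital $u\ge 0$ is $$\psi_\varepsilon(u)=\mathbb P\Big(\sup_{t\ge 0}\Big(\sum_{i=1}^{N(t)}U_i-t\Big)>u\Big).$$ Assume that the claim size distribution is a mixture of an exponential and a heavy-tailed distribution, with Laplace transform $$\mathbb E\,e^{-sU_1}=(1-\varepsilon)\frac{\nu}{s+\nu}+\varepsilon\Big(1-\frac{s}{(\mu+\sqrt s)(1+\sqrt s)}\Big),\qquad s>0.$$ Then $U_1$ has finite mean and $\rho_\varepsilon:=\lambda\,\mathbb E U_1=\frac{\lambda}{\mu\nu}\big(\mu+\varepsilon(\nu-\mu)\big)$. Assume that $\rho_\varepsilon<1$. Let $-\nu_1,\dots,-\nu_4$ be the complex roots, listed with multiplicity, of $$d(x)=x^4+(\mu+1)x^3+(\mu+\nu-\lambda)x^2+(\mu+1)(\nu-\lambda+\lambda\varepsilon)x+\big(\mu(\nu-\lambda)+\lambda\varepsilon(\mu-\nu)\big),$$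 and let $n(x)=(1-\varepsilon)(\mu+x)(1+x)+\varepsilon(x^2+\nu)$. Then all $\nu_i$ are non-zero. Suppose that the limits $$a_i=\lim_{x\to-\nu_i}\frac{n(x)}{d(x)}\,(x+\nu_i),\qquad i=1,\dots,4,$$ exist in $\mathbb C$; they do whenever the roots are distinct. Then, for every $u\ge 0$, $$\psi_\varepsilon(u)=\frac{\lambda}{\mu\nu}\Big(\mu\nu-\lambda\big(\mu+\varepsilon(\nu-\mu)\big)\Big)\sum_{i=1}^4\frac{a_i}{\nu_i}\,e^{\nu_i^2u}\,\operatorname{erfc}\big(\nu_i\sqrt u\big),$$ where $\operatorname{erfc}(z)=1-\frac{2}{\sqrt\pi}\int_0^z e^{-t^2}\,dt$ is the entire complementary error function. -/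

import Mathlib

open MeasureTheory ProbabilityTheory Filter Topology Polynomial

noncomputable section

namespace RiskModel

/-- The epoch of claim number `n` (numbered from `0`): the sum of the inter-arrival times
`τ 0, …, τ n`. -/
def arrivalTime {Ω : Type*} (τ : ℕ → Ω → ℝ) (n : ℕ) (ω : Ω) : ℝ :=
  ∑ i ∈ Finset.range (n + 1), τ i ω

/-- The number `N(t)` of claims that arrive up to time `t` (finite almost surely when the
inter-arrival times are i.i.d. exponential). -/
def claimCount {Ω : Type*} (τ : ℕ → Ω → ℝ) (t : ℝ) (ω : Ω) : ℕ :=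
  {n : ℕ | arrivalTime τ n ω ≤ t}.ncard

/-- The risk reserve at time `t` with initial capital `u` and premium rate `1`. -/
def riskReserve {Ω : Type*} (τ U : ℕ → Ω → ℝ) (u t : ℝ) (ω : Ω) : ℝ :=
  u + t - ∑ i ∈ Finset.range (claimCount τ t ω), U i ω

/-- The claim surplus `S(t) = u - R(t)`; it does not depend on the initial capital, which is
therefore put equal to `0`. -/
def claimSurplus {Ω : Type*} (τ U : ℕ → Ω → ℝ) (t : ℝ) (ω : Ω) : ℝ :=
  -riskReserve τ U 0 t ω

/-- The all-time maximum of the claim surplus, with values in the extended reals. -/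
def maxSurplus {Ω : Type*} (τ U : ℕ → Ω → ℝ) (ω : Ω) : EReal :=
  ⨆ t : Set.Ici (0 : ℝ), (claimSurplus τ U t ω : EReal)

/-- The probability of ultimate ruin with initial capital `u`. -/
def ruinProb {Ω : Type*} [MeasurableSpace Ω] (P : Measure Ω) (τ U : ℕ → Ω → ℝ) (u : ℝ) : ℝ :=
  P.real {ω | (u : EReal) < maxSurplus τ U ω}

/-- The classical Cramér–Lundberg model: claims arrive according to a Poisson process with rate
`lam` (given by its i.i.d. `Exp(lam)` inter-arrival times `τ`), the claim sizes `U` are i.i.d.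
nonnegative with distribution `G`, and they are independent of the arrivals. -/
structure IsCramerLundberg {Ω : Type*} [MeasurableSpace Ω] (P : Measure Ω) (lam : ℝ)
    (G : Measure ℝ) (τ U : ℕ → Ω → ℝ) : Prop where
  measurable_interarrival : ∀ i, Measurable (τ i)
  measurable_claim : ∀ i, Measurable (U i)
  law_interarrival : ∀ i, P.map (τ i) = expMeasure lam
  law_claim : ∀ i, P.map (U i) = G
  claim_nonneg : G (Set.Iio 0) = 0
  indep : iIndepFun (Sum.elim τ U : ℕ ⊕ ℕ → Ω → ℝ) P

/-- The complementary error function on the complex plane, `1 - (2/√π) ∫_0^z exp(-t²) dt`, the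
integral being taken along the segment from `0` to `z`. -/
def erfc (z : ℂ) : ℂ :=
  1 - 2 / (Real.sqrt Real.pi : ℂ) * ∫ t in (0 : ℝ)..1, z * Complex.exp (-(z * (t : ℂ)) ^ 2)

/-- The Laplace transform of the claim size distribution: a mixture of an exponential distribution
with rate `ν` and a long-tailed distribution with mean `1 / μ`. -/
def claimLT (μ ν ε s : ℝ) : ℝ :=
  (1 - ε) * (ν / (s + ν)) +
    ε * (1 - s / ((μ + Real.sqrt s) * (1 + Real.sqrt s)))

/-- The average amount of claims per unit time. -/
def load (lam μ ν ε : ℝ) : ℝ := lam / (μ * ν) * (μ + ε * (ν - μ))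

/-- The quartic `d`. -/
def denPoly (lam μ ν ε : ℝ) : ℂ[X] :=
  X ^ 4 + C ((μ + 1 : ℝ) : ℂ) * X ^ 3 + C ((μ + ν - lam : ℝ) : ℂ) * X ^ 2
    + C (((μ + 1) * (ν - lam + lam * ε) : ℝ) : ℂ) * X
    + C ((μ * (ν - lam) + lam * ε * (μ - ν) : ℝ) : ℂ)

/-- The numerator `n`. -/
def numPoly (μ ν ε : ℝ) : ℂ[X] :=
  C ((1 - ε : ℝ) : ℂ) * (C (μ : ℂ) + X) * (1 + X) + C (ε : ℂ) * (X ^ 2 + C (ν : ℂ))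

/-- `a i` is the limit of `n x / d x * (x + r i)` as `x` tends to `-r i`, for every `i`. -/
def IsResidueFamily (lam μ ν ε : ℝ) (r a : Fin 4 → ℂ) : Prop :=
  ∀ i, Tendsto (fun x : ℂ => (numPoly μ ν ε).eval x / (denPoly lam μ ν ε).eval x * (x + r i))
    (𝓝[≠] (-r i)) (𝓝 (a i))

end RiskModel

end

/-!
The maximal claim surplus is attained at claim epochs, so almost surely it is the supremum `M` of
the random walk with steps `U i - τ i` (`lt_maxSurplus_iff`); the load is below one, so the law of
large numbers makes `M` finite. Removing the first step gives `M = max 0 (U 0 + M' - τ 0)` with `M'`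
distributed like `M` and independent of `U 0`, and `U 0 + M'` independent of the exponential variable
`τ 0`. Integrating `τ 0` out turns this identity into a linear equation for the Laplace transform of
`M`, whose one unknown constant is found by letting the argument tend to zero. This is the
Pollaczek–Khinchine formula `IsCramerLundberg.integral_exp_walkSup_mul_eq`; the layer cake formula
converts it to the Laplace transform of the ruin probability.

For the given claim size distribution and with `x = √s`, this transform is rational in `x`, with
denominator `x ^ 2 * d x`, and the partial fraction expansion of `n / d` (`sum_residue_div`) writes
it as a linear combination of the functions `1 / (x * (x + r i))`. Each of these is the Laplace
transform of `exp (r i ^ 2 * u) * erfc (r i * √u)` (`integral_exp_smul_expErfc`), since the latter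
function solves a first-order linear differential equation. The claim follows from the uniqueness of
Laplace transforms (`ae_eq_zero_of_integral_exp_neg_nat_mul`, a form of the Weierstrass approximation
theorem) and from right continuity of both sides.

The expansion of `n / d` needs care when `d` has a multiple root, because such a root is listed
repeatedly. If the limit defining `a i` exists at a multiple root, then `n` vanishes there too, and
this happens only for `ε = 0` and `μ = 1`, with `-1` as double root of both `n` and `d`
(`eq_zero_and_eq_one_of_common_double_root`). The limits at `-1` are then zero, so that counting them
twice does no harm.
-/

namespace RiskModel

/-! ### Uniqueness of Laplace transforms -/

/-- Uniqueness of Laplace transforms, from their values at the natural numbers: the substitution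
`y = exp (-u)` turns test functions on `(0, ∞)` into continuous functions on `[0, 1]`, which are
uniform limits of polynomials in `y`. -/
theorem ae_eq_zero_of_integral_exp_neg_nat_mul {f : ℝ → ℂ} (hf : IntegrableOn f (Set.Ioi 0))
    (h : ∀ n : ℕ, ∫ u in Set.Ioi (0 : ℝ), Real.exp (-u) ^ n • f u = 0) :
    ∀ᵐ u : ℝ, u ∈ Set.Ioi (0 : ℝ) → f u = 0 := by
  refine isOpen_Ioi.ae_eq_zero_of_integral_contDiff_smul_eq_zero hf.locallyIntegrableOn ?_
  intro g hg hgc hgs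
  have hg0 : ∀ u ∉ Set.Ioi (0 : ℝ), g u = 0 := fun u hu =>
    image_eq_zero_of_notMem_tsupport fun hu' => hu (hgs hu')
  have hpoly : ∀ p : ℝ[X], IntegrableOn (fun u => p.eval (Real.exp (-u)) • f u) (Set.Ioi 0) ∧
      ∫ u in Set.Ioi (0 : ℝ), p.eval (Real.exp (-u)) • f u = 0 := by
    intro p
    have hmon : ∀ n : ℕ, IntegrableOn (fun u => Real.exp (-u) ^ n • f u) (Set.Ioi 0) := by
      intro n
      refine Integrable.mono hf ?_ ?_
      · exact (show Continuous fun u : ℝ => Real.exp (-u) ^ n by fun_prop).aestronglyMeasurable.smul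
          hf.aestronglyMeasurable
      · filter_upwards [ae_restrict_mem measurableSet_Ioi] with u hu
        rw [norm_smul]
        have : ‖Real.exp (-u) ^ n‖ ≤ 1 := by
          rw [Real.norm_of_nonneg (by positivity)]
          exact pow_le_one₀ (by positivity) (Real.exp_le_one_iff.2 (by simpa using le_of_lt hu))
        nlinarith [norm_nonneg (f u)]
    have hsum : ∀ u, p.eval (Real.exp (-u)) • f u =
        ∑ n ∈ Finset.range (p.natDegree + 1), p.coeff n • (Real.exp (-u) ^ n • f u) := by
      intro u
      rw [eval_eq_sum_range, Finset.sum_smul]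
      exact Finset.sum_congr rfl fun n _ => by rw [mul_smul]
    simp_rw [hsum]
    have hterm : ∀ n ∈ Finset.range (p.natDegree + 1),
        IntegrableOn (fun u => p.coeff n • (Real.exp (-u) ^ n • f u)) (Set.Ioi 0) :=
      fun n _ => (hmon n).smul (p.coeff n)
    refine ⟨integrable_finsetSum _ hterm, ?_⟩
    rw [integral_finsetSum _ hterm]
    exact Finset.sum_eq_zero fun n _ => by rw [integral_smul, h n, smul_zero]
  have hcont : ContinuousOn (fun y => g (-Real.log y)) (Set.Icc 0 1) := by
    intro y _
    by_cases hy : y = 0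
    · subst hy
      have hev : (fun y => g (-Real.log y)) =ᶠ[𝓝 0] fun _ => 0 := by
        have h1 : Tendsto (fun y => -Real.log y) (𝓝[≠] 0) atTop :=
          tendsto_neg_atBot_atTop.comp Real.tendsto_log_nhdsNE_zero
        have h2 : ∀ᶠ u in atTop, g u = 0 := by
          exact (hasCompactSupport_iff_eventuallyEq.1 hgc).filter_mono
            (atTop_le_cocompact.trans coclosedCompact_eq_cocompact.ge)
        have h3 := h1.eventually h2
        rw [eventually_nhdsWithin_iff] at h3
        filter_upwards [h3] with y hy
        by_cases hy0 : y = 0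
        · subst hy0; simpa using hg0 0 (by simp)
        · exact hy hy0
      exact (continuousAt_const.congr hev.symm).continuousWithinAt
    · exact ((hg.continuous.continuousAt).comp (Real.continuousAt_log hy).neg).continuousWithinAt
  have hle : ∀ ε : ℝ, 0 < ε → ‖∫ u in Set.Ioi (0 : ℝ), g u • f u‖
      ≤ ε * ∫ u in Set.Ioi (0 : ℝ), ‖f u‖ := by
    intro ε hε
    obtain ⟨p, hp⟩ := exists_polynomial_near_of_continuousOn 0 1 _ hcont ε hε
    have hgi : IntegrableOn (fun u => g u • f u) (Set.Ioi 0) := by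
      obtain ⟨C, hC⟩ := hg.continuous.bounded_above_of_compact_support hgc
      exact Integrable.bdd_smul hf C hg.continuous.aestronglyMeasurable
        (Eventually.of_forall hC)
    have hsub : ∫ u in Set.Ioi (0 : ℝ), g u • f u =
        ∫ u in Set.Ioi (0 : ℝ), (g u • f u - p.eval (Real.exp (-u)) • f u) := by
      rw [integral_sub hgi (hpoly p).1, (hpoly p).2, sub_zero]
    rw [hsub, ← integral_const_mul]
    refine norm_integral_le_of_norm_le (hf.norm.const_mul ε) ?_
    filter_upwards [ae_restrict_mem measurableSet_Ioi] with u hu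
    rw [← sub_smul, norm_smul]
    refine mul_le_mul_of_nonneg_right ?_ (norm_nonneg _)
    have := hp (Real.exp (-u)) ⟨(Real.exp_pos _).le, Real.exp_le_one_iff.2 (by
      simpa using le_of_lt hu)⟩
    rw [Real.log_exp, neg_neg, abs_sub_comm] at this
    exact this.le
  have hzero : ∫ u in Set.Ioi (0 : ℝ), g u • f u = 0 := by
    rw [← norm_le_zero_iff]
    refine ge_of_tendsto (x := 𝓝[>] (0 : ℝ)) (f := fun ε => ε * ∫ u in Set.Ioi (0 : ℝ), ‖f u‖) ?_
      (eventually_nhdsWithin_of_forall fun ε hε => hle ε hε)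
    have : Tendsto (fun ε : ℝ => ε * ∫ u in Set.Ioi (0 : ℝ), ‖f u‖) (𝓝 0)
        (𝓝 (0 * ∫ u in Set.Ioi (0 : ℝ), ‖f u‖)) := tendsto_id.mul_const _
    rw [zero_mul] at this
    exact this.mono_left nhdsWithin_le_nhds
  rw [← hzero, setIntegral_eq_integral_of_forall_compl_eq_zero]
  intro u hu
  rw [hg0 u hu, zero_smul]

theorem eq_zero_of_ae_eq_zero_of_right_continuous {h : ℝ → ℂ}
    (hae : ∀ᵐ u : ℝ, u ∈ Set.Ioi (0 : ℝ) → h u = 0)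
    (hc : ∀ u, ContinuousWithinAt h (Set.Ici u) u) {u : ℝ} (hu : 0 ≤ u) : h u = 0 := by
  by_contra hne
  have hev : ∀ᶠ v in 𝓝[>] u, h v ≠ 0 :=
    ((hc u).mono Set.Ioi_subset_Ici_self).eventually_ne hne
  obtain ⟨b, hb, hsub⟩ := mem_nhdsGT_iff_exists_Ioo_subset.1 hev
  have hnull : volume (Set.Ioo u b) = 0 := by
    refine measure_mono_null (fun v hv => ?_) (ae_iff.1 hae)
    intro himp
    exact hsub hv (himp (lt_of_le_of_lt hu hv.1))
  rw [Real.volume_Ioo, ENNReal.ofReal_eq_zero] at hnull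
  exact absurd hb (not_lt.2 (sub_nonpos.1 hnull))

/-! ### The complementary error function and its Laplace transform -/

/-- With the real factor moved into the upper limit, the integral can be differentiated by the
fundamental theorem of calculus. -/
theorem erfc_mul_ofReal (z : ℂ) (x : ℝ) :
    erfc (z * x) = 1 - 2 / (Real.sqrt Real.pi : ℂ) *
      ∫ t in (0 : ℝ)..x, z * Complex.exp (-(z * (t : ℂ)) ^ 2) := by
  have := intervalIntegral.smul_integral_comp_mul_left (a := 0) (b := 1)
    (fun t : ℝ => z * Complex.exp (-(z * (t : ℂ)) ^ 2)) x
  simp only [mul_zero, mul_one] at this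
  rw [erfc, ← this, ← intervalIntegral.integral_smul]
  congr 3
  ext t
  rw [Complex.real_smul]
  push_cast
  ring_nf

theorem hasDerivAt_erfc_mul_ofReal (z : ℂ) (x : ℝ) :
    HasDerivAt (fun x : ℝ => erfc (z * x))
      (-(2 / (Real.sqrt Real.pi : ℂ) * (z * Complex.exp (-(z * (x : ℂ)) ^ 2)))) x := by
  simp_rw [erfc_mul_ofReal]
  have hc : Continuous fun t : ℝ => z * Complex.exp (-(z * (t : ℂ)) ^ 2) := by fun_prop
  exact ((hc.integral_hasStrictDerivAt 0 x).hasDerivAt.const_mul _).const_sub 1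

/-- The function `u ↦ exp (z ^ 2 * u) * erfc (z * √u)`, meant for `0 ≤ u`. -/
noncomputable def expErfc (z : ℂ) (u : ℝ) : ℂ :=
  Complex.exp (z ^ 2 * (u : ℂ)) * erfc (z * (Real.sqrt u : ℂ))

theorem continuous_expErfc (z : ℂ) : Continuous (expErfc z) := by
  have h : Continuous fun x : ℝ => erfc (z * x) :=
    continuous_iff_continuousAt.2 fun x => (hasDerivAt_erfc_mul_ofReal z x).continuousAt
  have h2 : Continuous fun u : ℝ => erfc (z * (Real.sqrt u : ℂ)) := h.comp Real.continuous_sqrt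
  unfold expErfc
  fun_prop

theorem expErfc_zero (z : ℂ) : expErfc z 0 = 1 := by
  simp [expErfc, erfc]

theorem norm_expErfc_le (z : ℂ) {u : ℝ} (hu : 0 ≤ u) :
    ‖expErfc z u‖ ≤ (1 + 2 * ‖z‖ * Real.sqrt u) * Real.exp (2 * ‖z‖ ^ 2 * u) := by
  have h1 : ‖Complex.exp (z ^ 2 * (u : ℂ))‖ ≤ Real.exp (‖z‖ ^ 2 * u) := by
    refine (Complex.norm_exp_le_exp_norm _).trans ?_
    rw [norm_mul, norm_pow, Complex.norm_real, Real.norm_of_nonneg hu]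
  have hs := Real.sqrt_nonneg u
  have h2 : ‖∫ t in (0 : ℝ)..Real.sqrt u, z * Complex.exp (-(z * (t : ℂ)) ^ 2)‖ ≤
      (‖z‖ * Real.exp (‖z‖ ^ 2 * u)) * |Real.sqrt u - 0| := by
    refine intervalIntegral.norm_integral_le_of_norm_le_const fun t ht => ?_
    rw [Set.uIoc_of_le hs] at ht
    rw [norm_mul]
    refine mul_le_mul_of_nonneg_left ?_ (norm_nonneg _)
    refine (Complex.norm_exp_le_exp_norm _).trans (Real.exp_le_exp.2 ?_)
    rw [norm_neg, norm_pow, norm_mul, mul_pow, Complex.norm_real, Real.norm_of_nonneg ht.1.le]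
    refine mul_le_mul_of_nonneg_left ?_ (by positivity)
    calc t ^ 2 ≤ Real.sqrt u ^ 2 := pow_le_pow_left₀ ht.1.le ht.2 2
      _ = u := Real.sq_sqrt hu
  have hπ : ‖(2 : ℂ) / (Real.sqrt Real.pi : ℂ)‖ ≤ 2 := by
    rw [norm_div, Complex.norm_real, Complex.norm_ofNat, Real.norm_of_nonneg (Real.sqrt_nonneg _)]
    refine div_le_self (by norm_num) (Real.one_le_sqrt.2 (by linarith [Real.pi_gt_three]))
  have h3 : ‖erfc (z * (Real.sqrt u : ℂ))‖ ≤
      (1 + 2 * ‖z‖ * Real.sqrt u) * Real.exp (‖z‖ ^ 2 * u) := by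
    rw [erfc_mul_ofReal]
    refine (norm_sub_le _ _).trans ?_
    rw [norm_mul, norm_one]
    rw [sub_zero, abs_of_nonneg hs] at h2
    have he : 1 ≤ Real.exp (‖z‖ ^ 2 * u) := Real.one_le_exp (by positivity)
    have := mul_le_mul hπ h2 (norm_nonneg _) (by norm_num)
    nlinarith
  rw [expErfc, norm_mul]
  calc _ ≤ Real.exp (‖z‖ ^ 2 * u) * ((1 + 2 * ‖z‖ * Real.sqrt u) * Real.exp (‖z‖ ^ 2 * u)) :=
        mul_le_mul h1 h3 (norm_nonneg _) (by positivity)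
    _ = _ := by
        rw [show 2 * ‖z‖ ^ 2 * u = ‖z‖ ^ 2 * u + ‖z‖ ^ 2 * u by ring, Real.exp_add]; ring

theorem norm_exp_smul_expErfc_le (z : ℂ) {s : ℝ} (hs : 2 * ‖z‖ ^ 2 + 2 ≤ s) {u : ℝ} (hu : 0 ≤ u) :
    ‖Real.exp (-(s * u)) • expErfc z u‖ ≤ (1 + 2 * ‖z‖) * Real.exp (-1 * u) := by
  have h := norm_expErfc_le z hu
  rw [norm_smul, Real.norm_of_nonneg (Real.exp_pos _).le]
  have h1 : Real.sqrt u ≤ Real.exp u :=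
    by
    refine le_trans ?_ (Real.add_one_le_exp u)
    nlinarith [Real.sq_sqrt hu, sq_nonneg (Real.sqrt u - 1), Real.sqrt_nonneg u]
  have h2 : 1 ≤ Real.exp u := Real.one_le_exp hu
  have h3 : 1 + 2 * ‖z‖ * Real.sqrt u ≤ (1 + 2 * ‖z‖) * Real.exp u := by
    nlinarith [norm_nonneg z]
  calc _ ≤ Real.exp (-(s * u)) * (((1 + 2 * ‖z‖) * Real.exp u) * Real.exp (2 * ‖z‖ ^ 2 * u)) := by
        gcongr
        exact h.trans (by gcongr)
    _ = (1 + 2 * ‖z‖) * Real.exp (-(s * u) + u + 2 * ‖z‖ ^ 2 * u) := by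
        rw [Real.exp_add, Real.exp_add]; ring
    _ ≤ _ := by
        gcongr
        nlinarith

theorem integrableOn_exp_smul_expErfc (z : ℂ) {s : ℝ} (hs : 2 * ‖z‖ ^ 2 + 2 ≤ s) :
    IntegrableOn (fun u => Real.exp (-(s * u)) • expErfc z u) (Set.Ioi 0) := by
  refine Integrable.mono' ((exp_neg_integrableOn_Ioi 0 one_pos).const_mul (1 + 2 * ‖z‖)) ?_ ?_
  · have := continuous_expErfc z
    exact (Continuous.aestronglyMeasurable (by fun_prop))
  · filter_upwards [ae_restrict_mem measurableSet_Ioi] with u hu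
    exact norm_exp_smul_expErfc_le z hs (le_of_lt hu)

/-- The Laplace transform of `expErfc z`. The function `g u = exp (-(s * u)) * expErfc z u` satisfies
`g' = (z ^ 2 - s) * g - z / √π * u ^ (-1 / 2) * exp (-(s * u))`; integrating this over `(0, ∞)` and
using `Γ(1 / 2) = √π` gives the value. -/
theorem integral_exp_smul_expErfc (z : ℂ) {s : ℝ} (hs : 2 * ‖z‖ ^ 2 + 2 ≤ s) :
    ∫ u in Set.Ioi (0 : ℝ), Real.exp (-(s * u)) • expErfc z u =
      1 / ((Real.sqrt s : ℂ) * (Real.sqrt s + z)) := by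
  have hs0 : 0 < s := by nlinarith [sq_nonneg ‖z‖]
  have hx0 : 0 < Real.sqrt s := Real.sqrt_pos.2 hs0
  have hπ : 0 < Real.sqrt Real.pi := Real.sqrt_pos.2 Real.pi_pos
  set c : ℂ := z / (Real.sqrt Real.pi : ℂ) with hc
  have hderiv : ∀ u ∈ Set.Ioi (0 : ℝ),
      HasDerivAt (fun u => Real.exp (-(s * u)) • expErfc z u)
        ((z ^ 2 - s) * (Real.exp (-(s * u)) • expErfc z u) -
          c * ((u ^ (1 / 2 - 1 : ℝ) * Real.exp (-(s * u)) : ℝ) : ℂ)) u := by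
    intro u hu
    have hu : 0 < u := hu
    have hsu := Real.sqrt_pos.2 hu
    have h1 : HasDerivAt (fun u : ℝ => erfc (z * (Real.sqrt u : ℂ))) _ u :=
      (hasDerivAt_erfc_mul_ofReal z (Real.sqrt u)).scomp u (Real.hasDerivAt_sqrt hu.ne')
    have h2 : HasDerivAt (fun u : ℝ => Complex.exp (z ^ 2 * (u : ℂ)))
        (Complex.exp (z ^ 2 * (u : ℂ)) * (z ^ 2 * 1)) u :=
      ((Complex.ofRealCLM.hasDerivAt (x := u)).const_mul (z ^ 2)).cexp
    have h3 : HasDerivAt (fun u : ℝ => Real.exp (-(s * u))) (Real.exp (-(s * u)) * (-(s * 1))) u :=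
      (((hasDerivAt_id u).const_mul s).neg).exp
    have h4 := h3.smul (h2.mul h1)
    refine h4.congr_deriv ?_
    have hpow : u ^ (1 / 2 - 1 : ℝ) = 1 / Real.sqrt u := by
      rw [show (1 / 2 - 1 : ℝ) = -(1 / 2) by norm_num, Real.rpow_neg hu.le, ← Real.sqrt_eq_rpow,
        one_div]
    have hcancel : Complex.exp (z ^ 2 * (u : ℂ)) *
        Complex.exp (-(z * (Real.sqrt u : ℂ)) ^ 2) = 1 := by
      rw [← Complex.exp_add, mul_pow, ← Complex.ofReal_pow, Real.sq_sqrt hu.le, ← neg_mul]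
      simp
    rw [hpow, expErfc, hc]
    simp only [Complex.real_smul, Pi.mul_apply]
    push_cast
    have e1 : (Real.sqrt u : ℂ) ≠ 0 := by exact_mod_cast hsu.ne'
    have e2 : (Real.sqrt Real.pi : ℂ) ≠ 0 := by exact_mod_cast hπ.ne'
    generalize Complex.exp (z ^ 2 * (u : ℂ)) = A at *
    generalize Complex.exp (-(z * (Real.sqrt u : ℂ)) ^ 2) = B at *
    generalize Complex.exp (-(s * u)) = E at *
    field_simp
    linear_combination (-z * E) * hcancel
  have hint := integrableOn_exp_smul_expErfc z hs
  have hint2 : IntegrableOn (fun u : ℝ => u ^ (1 / 2 - 1 : ℝ) * Real.exp (-(s * u)))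
      (Set.Ioi 0) := by
    have := integrableOn_rpow_mul_exp_neg_mul_rpow (p := 1) (s := 1 / 2 - 1) (b := s)
      (by norm_num) one_pos hs0
    simpa using this
  have hint3 : IntegrableOn (fun u : ℝ => c * ((u ^ (1 / 2 - 1 : ℝ) * Real.exp (-(s * u)) : ℝ) : ℂ))
      (Set.Ioi 0) := (hint2.ofReal (𝕜 := ℂ)).const_mul c
  have hlim : Tendsto (fun u => Real.exp (-(s * u)) • expErfc z u) atTop (𝓝 0) := by
    refine squeeze_zero_norm' (a := fun u => (1 + 2 * ‖z‖) * Real.exp (-1 * u)) ?_ ?_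
    · filter_upwards [eventually_ge_atTop 0] with u hu
      exact norm_exp_smul_expErfc_le z hs hu
    · simpa using (Real.tendsto_exp_neg_atTop_nhds_zero).const_mul (1 + 2 * ‖z‖)
  have hcont : Continuous fun u => Real.exp (-(s * u)) • expErfc z u := by
    have := continuous_expErfc z
    fun_prop
  have key := integral_Ioi_of_hasDerivAt_of_tendsto (a := 0) hcont.continuousWithinAt hderiv
    ((hint.const_mul _).sub hint3) hlim
  rw [integral_sub (hint.const_mul _) hint3, integral_const_mul, integral_const_mul,
    integral_complex_ofReal, Real.integral_rpow_mul_exp_neg_mul_Ioi (by norm_num) hs0,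
    Real.Gamma_one_half_eq, expErfc_zero, ← Real.sqrt_eq_rpow, Real.sqrt_div zero_le_one,
    Real.sqrt_one] at key
  simp only [mul_zero, neg_zero, Real.exp_zero, one_smul, zero_sub] at key
  set I := ∫ u in Set.Ioi (0 : ℝ), Real.exp (-(s * u)) • expErfc z u
  have e1 : (Real.sqrt s : ℂ) ≠ 0 := by exact_mod_cast hx0.ne'
  have e2 : (Real.sqrt Real.pi : ℂ) ≠ 0 := by exact_mod_cast hπ.ne'
  have e3 : (Real.sqrt s : ℂ) ^ 2 = s := by rw [← Complex.ofReal_pow, Real.sq_sqrt hs0.le]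
  have hnz : ‖z‖ < Real.sqrt s := Real.lt_sqrt_of_sq_lt (by nlinarith [sq_nonneg ‖z‖])
  have hne : ∀ w : ℂ, ‖w‖ = ‖z‖ → (Real.sqrt s : ℂ) - w ≠ 0 := by
    intro w hw h0
    rw [sub_eq_zero] at h0
    rw [← h0, Complex.norm_real, Real.norm_of_nonneg hx0.le] at hw
    exact hnz.ne' hw
  have e4 := hne z rfl
  have e5 : (Real.sqrt s : ℂ) + z ≠ 0 := by simpa using hne (-z) (norm_neg z)
  rw [eq_div_iff (mul_ne_zero e1 e5)]
  rw [hc, ← e3] at key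
  push_cast at key
  field_simp at key
  apply mul_left_cancel₀ e4
  linear_combination -key

/-! ### The exponential distribution -/

theorem integral_expMeasure {r : ℝ} (hr : 0 < r) (g : ℝ → ℝ) :
    ∫ t, g t ∂expMeasure r = ∫ t in Set.Ioi (0 : ℝ), r * Real.exp (-(r * t)) * g t := by
  have h : expMeasure r = volume.withDensity (exponentialPDF r) := rfl
  have hm : Measurable (exponentialPDF r) := (measurable_exponentialPDFReal r).ennreal_ofReal
  rw [h, integral_withDensity_eq_integral_toReal_smul hm
    (Eventually.of_forall fun _ => ENNReal.ofReal_lt_top), ← integral_indicator measurableSet_Ioi]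
  refine integral_congr_ae ?_
  filter_upwards [Measure.ae_ne volume (0 : ℝ)] with t ht
  rw [exponentialPDF_eq, smul_eq_mul]
  by_cases h0 : 0 < t
  · rw [Set.indicator_of_mem (Set.mem_Ioi.2 h0), if_pos h0.le, ENNReal.toReal_ofReal (by positivity)]
  · rw [Set.indicator_of_notMem (by simpa using h0),
      if_neg (fun h => h0 (lt_of_le_of_ne h ht.symm))]
    simp

theorem ae_pos_expMeasure (r : ℝ) : ∀ᵐ t ∂expMeasure r, 0 < t := by
  have h : expMeasure r = volume.withDensity (exponentialPDF r) := rfl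
  have hm : Measurable (exponentialPDF r) := (measurable_exponentialPDFReal r).ennreal_ofReal
  rw [h, ae_withDensity_iff hm]
  filter_upwards [Measure.ae_ne volume (0 : ℝ)] with t ht hpdf
  by_contra hneg
  exact hpdf (exponentialPDF_of_neg (lt_of_le_of_ne (not_lt.1 hneg) ht))

theorem integral_id_expMeasure {r : ℝ} (hr : 0 < r) : ∫ t, t ∂expMeasure r = 1 / r := by
  rw [integral_expMeasure hr]
  have h := Real.integral_rpow_mul_exp_neg_mul_Ioi (a := 2) (r := r) (by norm_num) hr
  have h2 : Real.Gamma 2 = 1 := by simp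
  rw [show (2 : ℝ) - 1 = 1 by norm_num, h2, mul_one] at h
  simp only [Real.rpow_one, Real.rpow_ofNat] at h
  calc _ = r * ∫ t in Set.Ioi (0 : ℝ), t * Real.exp (-(r * t)) := by
        rw [← integral_const_mul]
        congr 1; ext t; ring
    _ = _ := by rw [h]; field_simp

theorem integrable_id_expMeasure {r : ℝ} (hr : 0 < r) :
    Integrable (fun t : ℝ => t) (expMeasure r) := by
  -- a non-integrable function would have Bochner integral zero
  by_contra h
  have h1 := integral_id_expMeasure hr
  rw [integral_undef h] at h1
  exact (one_div_pos.2 hr).ne h1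

/-- The inner integral of Lindley's recursion: the Laplace transform of the positive part of `w - t`
for exponentially distributed `t`. -/
theorem integral_exp_max_sub_expMeasure {r s w : ℝ} (hr : 0 < r) (hrs : r ≠ s) (hw : 0 ≤ w) :
    ∫ t, Real.exp (-s * max 0 (w - t)) ∂expMeasure r =
      (r * Real.exp (-s * w) - s * Real.exp (-r * w)) / (r - s) := by
  have hrs' : r - s ≠ 0 := sub_ne_zero.2 hrs
  rw [integral_expMeasure hr, ← Set.Ioc_union_Ioi_eq_Ioi hw]
  have e1 : Set.EqOn (fun t => r * Real.exp (-(r * t)) * Real.exp (-s * max 0 (w - t)))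
      (fun t => r * Real.exp (-s * w + (s - r) * t)) (Set.Ioc 0 w) := by
    intro t ht
    simp only
    rw [max_eq_right (by linarith [ht.2]), mul_assoc, ← Real.exp_add]
    ring_nf
  have e2 : Set.EqOn (fun t => r * Real.exp (-(r * t)) * Real.exp (-s * max 0 (w - t)))
      (fun t => r * Real.exp (-r * t)) (Set.Ioi w) := by
    intro t ht
    simp only
    rw [max_eq_left (by linarith [Set.mem_Ioi.1 ht])]
    simp
  have i1 : IntegrableOn (fun t => r * Real.exp (-s * w + (s - r) * t)) (Set.Ioc 0 w) :=
    (Continuous.integrableOn_Icc (by fun_prop)).mono_set Set.Ioc_subset_Icc_self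
  have i2 : IntegrableOn (fun t => r * Real.exp (-r * t)) (Set.Ioi w) :=
    (integrableOn_exp_mul_Ioi (neg_lt_zero.2 hr) w).const_mul r
  rw [setIntegral_union (Set.Ioc_disjoint_Ioi le_rfl) measurableSet_Ioi
    (i1.congr_fun e1.symm measurableSet_Ioc) (i2.congr_fun e2.symm measurableSet_Ioi),
    setIntegral_congr_fun measurableSet_Ioc e1, setIntegral_congr_fun measurableSet_Ioi e2,
    integral_const_mul r (fun t => Real.exp (-r * t)), integral_exp_mul_Ioi (neg_lt_zero.2 hr),
    ← intervalIntegral.integral_of_le hw,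
    intervalIntegral.integral_eq_sub_of_hasDerivAt
      (f := fun t => -(r / (r - s)) * Real.exp (-s * w + (s - r) * t))]
  · rw [show -s * w + (s - r) * w = -r * w by ring, mul_zero, add_zero]
    field_simp
    ring
  · intro t _
    refine ((((hasDerivAt_id t).const_mul (s - r)).const_add (-s * w)).exp.const_mul _).congr_deriv ?_
    simp only [id_eq]
    field_simp
    ring
  · exact Continuous.intervalIntegrable (by fun_prop) _ _

/-! ### Tails and means through Laplace transforms -/

/-- The Laplace transform of the tail of a nonnegative random variable, by the layer cake formula. -/
theorem integral_exp_mul_measureReal {Ω : Type*} [MeasurableSpace Ω] {P : Measure Ω} {X : Ω → ℝ} [IsProbabilityMeasure P]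
    (hX : Measurable X) (hnn : ∀ ω, 0 ≤ X ω) {s : ℝ} (hs : 0 < s) :
    ∫ u in Set.Ioi (0 : ℝ), Real.exp (-(s * u)) * P.real {ω | u < X ω} =
      (1 - ∫ ω, Real.exp (-s * X ω) ∂P) / s := by
  have hprim : ∀ x : ℝ, ∫ t in (0 : ℝ)..x, Real.exp (-(s * t)) = (1 - Real.exp (-s * x)) / s := by
    intro x
    rw [intervalIntegral.integral_eq_sub_of_hasDerivAt
      (f := fun t => -(Real.exp (-(s * t)) / s))]
    · rw [mul_zero, neg_zero, Real.exp_zero, neg_mul]; ring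
    · intro t _
      refine ((((hasDerivAt_id t).const_mul s).neg).exp.div_const s).neg.congr_deriv ?_
      simp only [Pi.neg_apply, id_eq]
      field_simp
    · exact Continuous.intervalIntegrable (by fun_prop) _ _
  have hlayer := lintegral_comp_eq_lintegral_meas_lt_mul P (f := X)
    (g := fun t => Real.exp (-(s * t))) (Eventually.of_forall hnn) hX.aemeasurable
    (fun t _ => Continuous.intervalIntegrable (by fun_prop) _ _)
    (Eventually.of_forall fun t => (Real.exp_pos _).le)
  simp only [hprim] at hlayer
  have hexp : Integrable (fun ω => Real.exp (-s * X ω)) P := by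
    refine Integrable.mono' (integrable_const (1 : ℝ)) (by fun_prop)
      (Eventually.of_forall fun ω => ?_)
    rw [Real.norm_of_nonneg (Real.exp_pos _).le]
    exact Real.exp_le_one_iff.2 (by nlinarith [hnn ω])
  have hanti : Antitone fun u => P.real {ω | u < X ω} := fun a b hab =>
    measureReal_mono fun ω (hω : b < X ω) => lt_of_le_of_lt hab hω
  have hmeas : Measurable fun u => Real.exp (-(s * u)) * P.real {ω | u < X ω} :=
    (show Measurable fun u => Real.exp (-(s * u)) by fun_prop).mul hanti.measurable
  rw [integral_eq_lintegral_of_nonneg_ae (Eventually.of_forall fun u => by positivity)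
    hmeas.aestronglyMeasurable]
  have e : ∀ u, ENNReal.ofReal (Real.exp (-(s * u)) * P.real {ω | u < X ω}) =
      P {ω | u < X ω} * ENNReal.ofReal (Real.exp (-(s * u))) := fun u => by
    rw [ENNReal.ofReal_mul (Real.exp_pos _).le, ofReal_measureReal, mul_comm]
  simp_rw [e]
  rw [← hlayer, ← integral_eq_lintegral_of_nonneg_ae, integral_div,
    integral_sub (integrable_const _) hexp]
  · simp
  · refine Eventually.of_forall fun ω => div_nonneg (sub_nonneg.2 ?_) hs.le
    exact Real.exp_le_one_iff.2 (by nlinarith [hnn ω])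
  · fun_prop

theorem continuousWithinAt_measureReal_lt {Ω : Type*} [MeasurableSpace Ω] {P : Measure Ω} {X : Ω → ℝ} [IsProbabilityMeasure P]
    (hX : Measurable X) (u : ℝ) :
    ContinuousWithinAt (fun u => P.real {ω | u < X ω}) (Set.Ici u) u := by
  have : IsProbabilityMeasure (P.map X) := Measure.isProbabilityMeasure_map hX.aemeasurable
  have e : (fun u => P.real {ω | u < X ω}) = fun u => 1 - cdf (P.map X) u := by
    ext v
    rw [cdf_eq_real, map_measureReal_apply hX measurableSet_Iic,
      ← probReal_compl_eq_one_sub (hX measurableSet_Iic)]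
    congr 1
    ext ω
    simp
  rw [e]
  exact continuousWithinAt_const.sub ((cdf (P.map X)).right_continuous u)

/-- The mean is minus the one-sided derivative at zero of the Laplace transform:
`(1 - exp (-s * x)) / s` is bounded by `x` and tends to `x`, so Fatou's lemma gives integrability and dominated convergence
the value. -/
theorem integrable_of_tendsto_one_sub_integral_exp {G : Measure ℝ} [IsProbabilityMeasure G]
    (hnn : ∀ᵐ x ∂G, 0 ≤ x) {m : ℝ}
    (hm : Tendsto (fun s => (1 - ∫ x, Real.exp (-s * x) ∂G) / s) (𝓝[>] 0) (𝓝 m)) :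
    Integrable (fun x : ℝ => x) G ∧ ∫ x, x ∂G = m := by
  set f : ℝ → ℝ → ℝ := fun s x => (1 - Real.exp (-s * x)) / s with hf
  have hlim : ∀ x, Tendsto (fun s => f s x) (𝓝[>] 0) (𝓝 x) := by
    intro x
    have h1 : HasDerivAt (fun s => -Real.exp (-s * x)) x 0 := by
      refine (((hasDerivAt_id (0 : ℝ)).neg.mul_const x).exp.neg).congr_deriv ?_
      simp
    refine ((hasDerivAt_iff_tendsto_slope.1 h1).mono_left
      (nhdsWithin_mono 0 fun s hs => ne_of_gt hs)).congr fun s => ?_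
    rw [slope_def_field, hf]
    simp
    ring
  have hbound : ∀ s x, 0 < s → 0 ≤ x → 0 ≤ f s x ∧ f s x ≤ x := by
    intro s x hs hx
    constructor
    · exact div_nonneg (sub_nonneg.2 (Real.exp_le_one_iff.2 (by nlinarith))) hs.le
    · rw [div_le_iff₀ hs]
      linarith [Real.add_one_le_exp (-s * x)]
  have hfint : ∀ s, 0 < s → ∫ x, f s x ∂G = (1 - ∫ x, Real.exp (-s * x) ∂G) / s := by
    intro s hs
    have : Integrable (fun x => Real.exp (-s * x)) G := by
      refine Integrable.mono' (integrable_const (1 : ℝ)) (by fun_prop) ?_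
      filter_upwards [hnn] with x hx
      rw [Real.norm_of_nonneg (Real.exp_pos _).le]
      exact Real.exp_le_one_iff.2 (by nlinarith)
    rw [hf, integral_div, integral_sub (integrable_const _) this]
    simp
  have hfm : ∀ s, AEStronglyMeasurable (f s) G := fun s => by
    rw [hf]; exact Measurable.aestronglyMeasurable (by fun_prop)
  have hint : Integrable (fun x : ℝ => x) G := by
    refine ⟨measurable_id.aestronglyMeasurable, ?_⟩
    rw [hasFiniteIntegral_iff_ofReal hnn]
    have hfatou := lintegral_liminf_le' (μ := G) (u := 𝓝[>] (0 : ℝ))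
      (f := fun s x => ENNReal.ofReal (f s x)) fun s => (hfm s).aemeasurable.ennreal_ofReal
    have h1 : ∀ x, liminf (fun s => ENNReal.ofReal (f s x)) (𝓝[>] 0) = ENNReal.ofReal x :=
      fun x => (ENNReal.tendsto_ofReal (hlim x)).liminf_eq
    have h2 : Tendsto (fun s => ∫⁻ x, ENNReal.ofReal (f s x) ∂G) (𝓝[>] 0)
        (𝓝 (ENNReal.ofReal m)) := by
      refine (ENNReal.tendsto_ofReal hm).congr' ?_
      filter_upwards [self_mem_nhdsWithin] with s hs
      have hs : 0 < s := hs
      rw [← hfint s hs, ofReal_integral_eq_lintegral_ofReal]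
      · refine (integrable_const (1 / s)).mono' (hfm s) ?_
        filter_upwards [hnn] with x hx
        rw [Real.norm_of_nonneg (hbound s x hs hx).1]
        exact div_le_div_of_nonneg_right (by linarith [Real.exp_pos (-s * x)]) hs.le
      · filter_upwards [hnn] with x hx using (hbound s x hs hx).1
    simp only [h1, h2.liminf_eq] at hfatou
    exact hfatou.trans_lt ENNReal.ofReal_lt_top
  refine ⟨hint, ?_⟩
  have hdct : Tendsto (fun s => ∫ x, f s x ∂G) (𝓝[>] 0) (𝓝 (∫ x, x ∂G)) := by
    refine tendsto_integral_filter_of_dominated_convergence (fun x => x)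
      (Eventually.of_forall hfm) ?_ hint (Eventually.of_forall hlim)
    filter_upwards [self_mem_nhdsWithin] with s hs
    filter_upwards [hnn] with x hx
    rw [Real.norm_of_nonneg (hbound s x hs hx).1]
    exact (hbound s x hs hx).2
  refine tendsto_nhds_unique hdct (hm.congr' ?_)
  filter_upwards [self_mem_nhdsWithin] with s hs
  exact (hfint s hs).symm

/-! ### The supremum of a walk and the maximal claim surplus -/

/-- The supremum over all `n` (including `0`) of the walk with steps `x 0, x 1, …`. It is `0` if the
walk is not bounded above. -/
noncomputable def walkSup (x : ℕ → ℝ) : ℝ := ⨆ n, ∑ i ∈ Finset.range n, x i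

theorem walkSup_nonneg (x : ℕ → ℝ) : 0 ≤ walkSup x :=
  Real.iSup_nonneg' ⟨0, by simp⟩

theorem measurable_walkSup : Measurable walkSup :=
  Measurable.iSup fun _ => Finset.measurable_sum _ fun i _ => measurable_pi_apply i

/-- Lindley's recursion: decomposition of the supremum according to the first step. -/
theorem walkSup_eq_max {x : ℕ → ℝ}
    (h : BddAbove (Set.range fun n => ∑ i ∈ Finset.range n, x i)) :
    walkSup x = max 0 (x 0 + walkSup fun i => x (i + 1)) := by
  have hstep : ∀ n, x 0 + ∑ i ∈ Finset.range n, x (i + 1) ≤ walkSup x := fun n => by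
    have := le_ciSup h (n + 1)
    rwa [Finset.sum_range_succ', add_comm] at this
  have h' : BddAbove (Set.range fun n => ∑ i ∈ Finset.range n, x (i + 1)) :=
    ⟨walkSup x - x 0, by rintro _ ⟨n, rfl⟩; linarith [hstep n]⟩
  refine le_antisymm (ciSup_le fun n => ?_) (max_le (walkSup_nonneg x) ?_)
  · cases n with
    | zero => simp
    | succ n =>
      rw [Finset.sum_range_succ', add_comm]
      exact le_max_of_le_right (add_le_add_right (le_ciSup h' n) _)
  · have : (walkSup fun i => x (i + 1)) ≤ walkSup x - x 0 :=
      ciSup_le fun n => by linarith [hstep n]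
    linarith

theorem lt_walkSup_iff {x : ℕ → ℝ}
    (h : BddAbove (Set.range fun n => ∑ i ∈ Finset.range n, x i)) (u : ℝ) :
    u < walkSup x ↔ ∃ n, u < ∑ i ∈ Finset.range n, x i :=
  lt_ciSup_iff h

section Path

variable {Ω : Type*} {τ U : ℕ → Ω → ℝ} {ω : Ω}

theorem strictMono_sum_range (hpos : ∀ i, 0 < τ i ω) :
    StrictMono fun n => ∑ i ∈ Finset.range n, τ i ω :=
  strictMono_nat_of_lt_succ fun n => by
    rw [Finset.sum_range_succ]
    exact lt_add_of_pos_right _ (hpos n)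

/-- When the arrival times increase strictly to infinity, the claims that have arrived by time `t`
form an initial segment, so `claimCount` is not the default value of `Set.ncard` on an infinite set. -/
theorem setOf_arrivalTime_le_eq (hpos : ∀ i, 0 < τ i ω)
    (htop : Tendsto (fun n => ∑ i ∈ Finset.range n, τ i ω) atTop atTop) (t : ℝ) :
    {n : ℕ | arrivalTime τ n ω ≤ t} = Set.Iio (claimCount τ t ω) := by
  classical
  have hex : ∃ n, t < arrivalTime τ n ω :=
    ((htop.comp (tendsto_add_atTop_nat 1)).eventually_gt_atTop t).exists
  have hset : {n : ℕ | arrivalTime τ n ω ≤ t} = Set.Iio (Nat.find hex) := by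
    ext n
    simp only [Set.mem_ofPred_eq, Set.mem_Iio]
    constructor
    · intro hn
      by_contra hle
      have h1 : arrivalTime τ (Nat.find hex) ω ≤ arrivalTime τ n ω :=
        (strictMono_sum_range hpos).monotone (Nat.succ_le_succ (not_lt.1 hle))
      exact absurd (Nat.find_spec hex) (not_lt.2 (h1.trans hn))
    · intro hn
      exact not_lt.1 (Nat.find_min hex hn)
  have hcount : claimCount τ t ω = Nat.find hex := by
    rw [claimCount, hset, ← Finset.coe_range, Set.ncard_coe_finset, Finset.card_range]
  rw [hset, hcount]

/-- Between claims the surplus decreases, so its supremum is that of its values at the epochs of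
claims and at time zero. -/
theorem lt_maxSurplus_iff (hpos : ∀ i, 0 < τ i ω)
    (htop : Tendsto (fun n => ∑ i ∈ Finset.range n, τ i ω) atTop atTop) (u : ℝ) :
    (u : EReal) < maxSurplus τ U ω ↔ ∃ n, u < ∑ i ∈ Finset.range n, (U i ω - τ i ω) := by
  have hsurplus : ∀ t, claimSurplus τ U t ω =
      ∑ i ∈ Finset.range (claimCount τ t ω), U i ω - t := fun t => by
    simp [claimSurplus, riskReserve]
  have hmem : ∀ n t, arrivalTime τ n ω ≤ t ↔ n < claimCount τ t ω := fun n t =>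
    Set.ext_iff.1 (setOf_arrivalTime_le_eq hpos htop t) n
  simp only [maxSurplus, lt_iSup_iff, EReal.coe_lt_coe_iff, hsurplus, Finset.sum_sub_distrib]
  constructor
  · rintro ⟨⟨t, ht⟩, hut⟩
    refine ⟨claimCount τ t ω, hut.trans_le (sub_le_sub_left ?_ _)⟩
    cases hN : claimCount τ t ω with
    | zero => simpa using ht
    | succ n => exact (hmem n t).2 (by omega)
  · rintro ⟨n, hn⟩
    have hT := (strictMono_sum_range hpos).monotone (Nat.zero_le n)
    simp only [Finset.range_zero, Finset.sum_empty] at hT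
    refine ⟨⟨_, hT⟩, ?_⟩
    -- exactly `n` claims have arrived at the epoch of the `n`-th claim
    have hcount : claimCount τ (∑ i ∈ Finset.range n, τ i ω) ω = n := by
      refine le_antisymm ?_ ?_
      · by_contra hlt
        exact absurd ((hmem n _).2 (not_le.1 hlt))
          (not_le.2 (strictMono_sum_range hpos (Nat.lt_succ_self n)))
      · cases n with
        | zero => exact Nat.zero_le _
        | succ n => exact (hmem n _).1 le_rfl
    simpa only [hcount] using hn

end Path

/-! ### The Cramér–Lundberg model -/

/-- One member of an independent family is independent of all the others jointly. -/
theorem indepFun_compl_of_iIndepFun {Ω ι : Type*} [MeasurableSpace Ω] {P : Measure Ω}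
    {f : ι → Ω → ℝ} (hf : iIndepFun f P) (hm : ∀ i, Measurable (f i)) (i : ι) :
    IndepFun (f i) (fun ω (j : {j // j ≠ i}) => f j ω) P := by
  have h := indep_iSup_of_disjoint (fun j => (hm j).comap_le) hf.iIndep
    (S := {i}) (T := {i}ᶜ) disjoint_compl_right
  rw [IndepFun_iff_Indep]
  refine indep_of_indep_of_le_left (indep_of_indep_of_le_right h ?_) ?_
  · rw [← measurable_iff_comap_le]
    refine @measurable_pi_lambda _ _ _ (_) _ _ fun j => ?_
    rw [measurable_iff_comap_le]
    exact le_iSup₂_of_le j.1 j.2 le_rfl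
  · exact le_iSup₂_of_le i rfl le_rfl

namespace IsCramerLundberg

variable {Ω : Type*} [MeasurableSpace Ω] {P : Measure Ω} {lam : ℝ} {G : Measure ℝ}
  {τ U : ℕ → Ω → ℝ}

theorem measurable_elim (h : IsCramerLundberg P lam G τ U) (k : ℕ ⊕ ℕ) :
    Measurable (Sum.elim τ U k : Ω → ℝ) := by
  cases k with
  | inl i => exact h.measurable_interarrival i
  | inr i => exact h.measurable_claim i

theorem ae_interarrival_pos (h : IsCramerLundberg P lam G τ U) :
    ∀ᵐ ω ∂P, ∀ i, 0 < τ i ω := by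
  refine ae_all_iff.2 fun i => ?_
  have := ae_pos_expMeasure lam
  rw [← h.law_interarrival i] at this
  exact ae_of_ae_map (h.measurable_interarrival i).aemeasurable this

theorem ae_nonneg (h : IsCramerLundberg P lam G τ U) : ∀ᵐ x ∂G, 0 ≤ x := by
  rw [ae_iff]
  simpa [not_le, ← Set.Iio_def] using h.claim_nonneg

theorem isProbabilityMeasure_claim [IsProbabilityMeasure P] (h : IsCramerLundberg P lam G τ U) :
    IsProbabilityMeasure G := by
  rw [← h.law_claim 0]
  exact Measure.isProbabilityMeasure_map (h.measurable_claim 0).aemeasurable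

theorem ae_claim_nonneg (h : IsCramerLundberg P lam G τ U) (i : ℕ) : ∀ᵐ ω ∂P, 0 ≤ U i ω := by
  have := h.ae_nonneg
  rw [← h.law_claim i] at this
  exact ae_of_ae_map (h.measurable_claim i).aemeasurable this

theorem ae_tendsto_interarrival_avg (h : IsCramerLundberg P lam G τ U) (hlam : 0 < lam) :
    ∀ᵐ ω ∂P, Tendsto (fun n : ℕ => (∑ i ∈ Finset.range n, τ i ω) / n) atTop (𝓝 (1 / lam)) := by
  have hid : ∀ i, IdentDistrib (τ i) (τ 0) P P := fun i =>
    ⟨(h.measurable_interarrival i).aemeasurable, (h.measurable_interarrival 0).aemeasurable, by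
      rw [h.law_interarrival, h.law_interarrival]⟩
  have hint : Integrable (τ 0) P := by
    have := integrable_id_expMeasure hlam
    rw [← h.law_interarrival 0] at this
    exact this.comp_measurable (h.measurable_interarrival 0)
  have hmean : ∫ ω, τ 0 ω ∂P = 1 / lam := by
    rw [← integral_id_expMeasure hlam, ← h.law_interarrival 0,
      integral_map (f := fun t : ℝ => t) (h.measurable_interarrival 0).aemeasurable
        measurable_id.aestronglyMeasurable]
  rw [← hmean]
  exact strong_law_ae_real τ hint
    (fun i j hij => h.indep.indepFun (i := Sum.inl i) (j := Sum.inl j) (by simpa using hij)) hid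

theorem ae_tendsto_claim_avg (h : IsCramerLundberg P lam G τ U)
    (hG : Integrable (fun x : ℝ => x) G) :
    ∀ᵐ ω ∂P, Tendsto (fun n : ℕ => (∑ i ∈ Finset.range n, U i ω) / n) atTop
      (𝓝 (∫ x, x ∂G)) := by
  have hid : ∀ i, IdentDistrib (U i) (U 0) P P := fun i =>
    ⟨(h.measurable_claim i).aemeasurable, (h.measurable_claim 0).aemeasurable, by
      rw [h.law_claim, h.law_claim]⟩
  have hint : Integrable (U 0) P := by
    rw [← h.law_claim 0] at hG
    exact hG.comp_measurable (h.measurable_claim 0)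
  have hmean : ∫ ω, U 0 ω ∂P = ∫ x, x ∂G := by
    rw [← h.law_claim 0, integral_map (f := fun t : ℝ => t)
      (h.measurable_claim 0).aemeasurable measurable_id.aestronglyMeasurable]
  rw [← hmean]
  exact strong_law_ae_real U hint
    (fun i j hij => h.indep.indepFun (i := Sum.inr i) (j := Sum.inr j) (by simpa using hij)) hid

theorem ae_tendsto_arrival (h : IsCramerLundberg P lam G τ U) (hlam : 0 < lam) :
    ∀ᵐ ω ∂P, Tendsto (fun n => ∑ i ∈ Finset.range n, τ i ω) atTop atTop := by
  filter_upwards [h.ae_tendsto_interarrival_avg hlam] with ω hω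
  refine (hω.pos_mul_atTop (one_div_pos.2 hlam) tendsto_natCast_atTop_atTop).congr' ?_
  filter_upwards [eventually_ne_atTop 0] with n hn
  exact div_mul_cancel₀ _ (Nat.cast_ne_zero.2 hn)

/-- By the law of large numbers the walk has negative drift when the load is below one. -/
theorem ae_bddAbove (h : IsCramerLundberg P lam G τ U) (hlam : 0 < lam)
    (hG : Integrable (fun x : ℝ => x) G) (hload : lam * ∫ x, x ∂G < 1) :
    ∀ᵐ ω ∂P, BddAbove (Set.range fun n => ∑ i ∈ Finset.range n, (U i ω - τ i ω)) := by
  filter_upwards [h.ae_tendsto_interarrival_avg hlam, h.ae_tendsto_claim_avg hG] with ω h1 h2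
  have hneg : ∫ x, x ∂G - 1 / lam < 0 := by
    rw [sub_neg, lt_div_iff₀ hlam, mul_comm]
    exact hload
  have hev : ∀ᶠ n : ℕ in atTop, ∑ i ∈ Finset.range n, (U i ω - τ i ω) ≤ 0 := by
    filter_upwards [(h2.sub h1).eventually_lt_const hneg, eventually_gt_atTop 0] with n hn hn0
    rw [← sub_div, ← Finset.sum_sub_distrib] at hn
    have hn0' : (0 : ℝ) < n := Nat.cast_pos.2 hn0
    by_contra hpos
    exact absurd hn (not_lt.2 (div_nonneg (not_le.1 hpos).le hn0'.le))
  exact IsBoundedUnder.bddAbove_range ⟨0, by simpa using hev⟩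

theorem ae_lt_maxSurplus_iff (h : IsCramerLundberg P lam G τ U) (hlam : 0 < lam)
    (hG : Integrable (fun x : ℝ => x) G) (hload : lam * ∫ x, x ∂G < 1) :
    ∀ᵐ ω ∂P, ∀ u : ℝ, (u : EReal) < maxSurplus τ U ω ↔ u < walkSup fun i => U i ω - τ i ω := by
  filter_upwards [h.ae_bddAbove hlam hG hload, h.ae_interarrival_pos, h.ae_tendsto_arrival hlam]
    with ω h1 h2 h3 u
  rw [lt_maxSurplus_iff h2 h3, lt_walkSup_iff h1]

theorem ruinProb_eq (h : IsCramerLundberg P lam G τ U) (hlam : 0 < lam)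
    (hG : Integrable (fun x : ℝ => x) G) (hload : lam * ∫ x, x ∂G < 1) (u : ℝ) :
    ruinProb P τ U u = P.real {ω | u < walkSup fun i => U i ω - τ i ω} := by
  refine measureReal_congr ?_
  filter_upwards [h.ae_lt_maxSurplus_iff hlam hG hload] with ω hω
  exact propext (hω u)

theorem measurable_walkSup (h : IsCramerLundberg P lam G τ U) :
    Measurable fun ω => walkSup fun i => U i ω - τ i ω :=
  RiskModel.measurable_walkSup.comp <| measurable_pi_lambda _ fun i =>
    (h.measurable_claim i).sub (h.measurable_interarrival i)

theorem measurable_walkSup_succ (h : IsCramerLundberg P lam G τ U) :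
    Measurable fun ω => walkSup fun i => U (i + 1) ω - τ (i + 1) ω :=
  RiskModel.measurable_walkSup.comp <| measurable_pi_lambda _ fun i =>
    (h.measurable_claim (i + 1)).sub (h.measurable_interarrival (i + 1))

/-- Dropping the first claim and the first inter-arrival time does not change the joint law of the
sequences. -/
theorem identDistrib_walkSup_succ (h : IsCramerLundberg P lam G τ U) :
    IdentDistrib (fun ω => walkSup fun i => U (i + 1) ω - τ (i + 1) ω)
      (fun ω => walkSup fun i => U i ω - τ i ω) P P := by
  have hinj : Function.Injective (Sum.map Nat.succ Nat.succ) :=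
    Sum.map_injective.2 ⟨Nat.succ_injective, Nat.succ_injective⟩
  have hjoint : IdentDistrib
      (fun ω (k : ℕ ⊕ ℕ) => (Sum.elim τ U (Sum.map Nat.succ Nat.succ k) : Ω → ℝ) ω)
      (fun ω (k : ℕ ⊕ ℕ) => (Sum.elim τ U k : Ω → ℝ) ω) P P := by
    refine ⟨(measurable_pi_lambda _ fun k => h.measurable_elim _).aemeasurable,
      (measurable_pi_lambda _ fun k => h.measurable_elim _).aemeasurable, ?_⟩
    rw [(h.indep.precomp hinj).map_fun_eq_infinitePi_map (fun k => h.measurable_elim _),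
      h.indep.map_fun_eq_infinitePi_map h.measurable_elim]
    congr 1
    ext1 k
    cases k with
    | inl i => simp [h.law_interarrival]
    | inr i => simp [h.law_claim]
  have hΦ : Measurable fun y : ℕ ⊕ ℕ → ℝ => walkSup fun i => y (Sum.inr i) - y (Sum.inl i) :=
    RiskModel.measurable_walkSup.comp <| measurable_pi_lambda _ fun i =>
      (measurable_pi_apply _).sub (measurable_pi_apply _)
  exact hjoint.comp hΦ

theorem indepFun_interarrival_zero (h : IsCramerLundberg P lam G τ U) :
    IndepFun (τ 0) (fun ω => U 0 ω + walkSup fun i => U (i + 1) ω - τ (i + 1) ω) P := by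
  have hind := indepFun_compl_of_iIndepFun h.indep h.measurable_elim (Sum.inl 0)
  have hΦ : Measurable fun y : {j : ℕ ⊕ ℕ // j ≠ Sum.inl 0} → ℝ =>
      y ⟨Sum.inr 0, by simp⟩ +
        walkSup fun i => y ⟨Sum.inr (i + 1), by simp⟩ - y ⟨Sum.inl (i + 1), by simp⟩ :=
    (measurable_pi_apply _).add <| RiskModel.measurable_walkSup.comp <|
      measurable_pi_lambda _ fun i => (measurable_pi_apply _).sub (measurable_pi_apply _)
  exact hind.comp measurable_id hΦ

theorem indepFun_claim_zero (h : IsCramerLundberg P lam G τ U) :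
    IndepFun (U 0) (fun ω => walkSup fun i => U (i + 1) ω - τ (i + 1) ω) P := by
  have hind := indepFun_compl_of_iIndepFun h.indep h.measurable_elim (Sum.inr 0)
  have hΦ : Measurable fun y : {j : ℕ ⊕ ℕ // j ≠ Sum.inr 0} → ℝ =>
      walkSup fun i => y ⟨Sum.inr (i + 1), by simp⟩ - y ⟨Sum.inl (i + 1), by simp⟩ :=
    RiskModel.measurable_walkSup.comp <|
      measurable_pi_lambda _ fun i => (measurable_pi_apply _).sub (measurable_pi_apply _)
  exact hind.comp measurable_id hΦ

theorem integral_exp_claim_add_walkSup (h : IsCramerLundberg P lam G τ U) (s : ℝ) :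
    ∫ ω, Real.exp (-s * (U 0 ω + walkSup fun i => U (i + 1) ω - τ (i + 1) ω)) ∂P =
      (∫ x, Real.exp (-s * x) ∂G) *
        ∫ ω, Real.exp (-s * walkSup fun i => U i ω - τ i ω) ∂P := by
  have hexp : Measurable fun x : ℝ => Real.exp (-s * x) := by fun_prop
  have h1 := (h.indepFun_claim_zero.comp hexp hexp).integral_fun_mul_eq_mul_integral
    (hexp.comp (h.measurable_claim 0)).aestronglyMeasurable
    (hexp.comp h.measurable_walkSup_succ).aestronglyMeasurable
  have h2 := (h.identDistrib_walkSup_succ.comp hexp).integral_eq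
  simp only [Function.comp_def] at h1 h2
  simp_rw [mul_add, Real.exp_add]
  rw [h1, h2, ← h.law_claim 0, integral_map (h.measurable_claim 0).aemeasurable
    hexp.aestronglyMeasurable]

/-- Lindley's recursion in terms of Laplace transforms. The constant on the right-hand side does not
depend on `s`. The value `s = lam` is excluded because the computation divides by `lam - s`. -/
theorem integral_exp_walkSup_mul (h : IsCramerLundberg P lam G τ U) [IsProbabilityMeasure P]
    (hlam : 0 < lam)
    (hG : Integrable (fun x : ℝ => x) G) (hload : lam * ∫ x, x ∂G < 1) {s : ℝ} (hs : 0 < s)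
    (hne : s ≠ lam) :
    (∫ ω, Real.exp (-s * walkSup fun i => U i ω - τ i ω) ∂P) *
        (s - lam + lam * ∫ x, Real.exp (-s * x) ∂G) =
      s * ∫ ω, Real.exp (-lam * (U 0 ω + walkSup fun i => U (i + 1) ω - τ (i + 1) ω)) ∂P := by
  have := isProbabilityMeasure_expMeasure hlam
  set W : Ω → ℝ := fun ω => U 0 ω + walkSup fun i => U (i + 1) ω - τ (i + 1) ω with hW
  have hWm : Measurable W := (h.measurable_claim 0).add h.measurable_walkSup_succ
  have hWnn : ∀ᵐ ω ∂P, 0 ≤ W ω := by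
    filter_upwards [h.ae_claim_nonneg 0] with ω hω
    exact add_nonneg hω (walkSup_nonneg _)
  have hWint : ∀ r : ℝ, 0 < r → Integrable (fun ω => Real.exp (-r * W ω)) P := fun r hr => by
    refine Integrable.mono' (integrable_const (1 : ℝ)) (by fun_prop) ?_
    filter_upwards [hWnn] with ω hω
    rw [Real.norm_of_nonneg (Real.exp_pos _).le]
    exact Real.exp_le_one_iff.2 (by nlinarith)
  have hrec : ∫ ω, Real.exp (-s * walkSup fun i => U i ω - τ i ω) ∂P =
      ∫ ω, Real.exp (-s * max 0 (W ω - τ 0 ω)) ∂P := by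
    refine integral_congr_ae ?_
    filter_upwards [h.ae_bddAbove hlam hG hload] with ω hω
    rw [walkSup_eq_max hω, hW]
    congr 3
    ring
  have hjoint : P.map (fun ω => (W ω, τ 0 ω)) = (P.map W).prod (expMeasure lam) := by
    rw [← h.law_interarrival 0]
    exact h.indepFun_interarrival_zero.symm.map_prod_eq_prod_map_map hWm.aemeasurable
      (h.measurable_interarrival 0).aemeasurable
  have hFm : Measurable fun p : ℝ × ℝ => Real.exp (-s * max 0 (p.1 - p.2)) := by fun_prop
  have : IsProbabilityMeasure (P.map W) := Measure.isProbabilityMeasure_map hWm.aemeasurable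
  have hFint : Integrable (fun p : ℝ × ℝ => Real.exp (-s * max 0 (p.1 - p.2)))
      ((P.map W).prod (expMeasure lam)) := by
    refine Integrable.mono' (integrable_const (1 : ℝ)) hFm.aestronglyMeasurable
      (Eventually.of_forall fun p => ?_)
    rw [Real.norm_of_nonneg (Real.exp_pos _).le]
    exact Real.exp_le_one_iff.2 (by nlinarith [le_max_left 0 (p.1 - p.2)])
  have hstep : ∫ ω, Real.exp (-s * max 0 (W ω - τ 0 ω)) ∂P =
      ∫ ω, (lam * Real.exp (-s * W ω) - s * Real.exp (-lam * W ω)) / (lam - s) ∂P := by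
    rw [← integral_map (φ := fun ω => (W ω, τ 0 ω))
      (f := fun p : ℝ × ℝ => Real.exp (-s * max 0 (p.1 - p.2)))
      (hWm.prodMk (h.measurable_interarrival 0)).aemeasurable hFm.aestronglyMeasurable, hjoint,
      integral_prod _ hFint, integral_map hWm.aemeasurable
        hFint.integral_prod_left.aestronglyMeasurable]
    refine integral_congr_ae ?_
    filter_upwards [hWnn] with ω hω
    exact integral_exp_max_sub_expMeasure hlam hne.symm hω
  have hW' := h.integral_exp_claim_add_walkSup s
  rw [integral_div, integral_sub ((hWint s hs).const_mul _) ((hWint lam hlam).const_mul _),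
    integral_const_mul, integral_const_mul, hW'] at hstep
  rw [← hrec, eq_div_iff (sub_ne_zero.2 hne.symm)] at hstep
  linear_combination -hstep

theorem tendsto_integral_exp_walkSup (h : IsCramerLundberg P lam G τ U) [IsProbabilityMeasure P] :
    Tendsto (fun s => ∫ ω, Real.exp (-s * walkSup fun i => U i ω - τ i ω) ∂P) (𝓝[>] 0) (𝓝 1) := by
  have : Tendsto (fun s => ∫ ω, Real.exp (-s * walkSup fun i => U i ω - τ i ω) ∂P) (𝓝[>] 0)
      (𝓝 (∫ _, (1 : ℝ) ∂P)) := by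
    refine tendsto_integral_filter_of_dominated_convergence (fun _ => (1 : ℝ)) ?_ ?_
      (integrable_const _) ?_
    · have := h.measurable_walkSup
      exact Eventually.of_forall fun s => (Real.measurable_exp.comp
        (this.const_mul (-s))).aestronglyMeasurable
    · filter_upwards [self_mem_nhdsWithin] with s hs
      refine Eventually.of_forall fun ω => ?_
      rw [Real.norm_of_nonneg (Real.exp_pos _).le]
      have hs : 0 < s := hs
      exact Real.exp_le_one_iff.2 (by nlinarith [walkSup_nonneg fun i => U i ω - τ i ω])
    · refine Eventually.of_forall fun ω => ?_
      have hc : Continuous fun s : ℝ => Real.exp (-s * walkSup fun i => U i ω - τ i ω) := by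
        fun_prop
      have := hc.tendsto 0
      simp only [neg_zero, zero_mul, Real.exp_zero] at this
      exact this.mono_left nhdsWithin_le_nhds
  simpa using this

end IsCramerLundberg

/-! ### The claim size transform and the Pollaczek–Khinchine formula -/

theorem one_sub_claimLT_div {μ ν : ℝ} (ε : ℝ) (hμ : 0 < μ) (hν : 0 < ν) {s : ℝ} (hs : 0 < s) :
    (1 - claimLT μ ν ε s) / s =
      (1 - ε) / (s + ν) + ε / ((μ + Real.sqrt s) * (1 + Real.sqrt s)) := by
  have h1 : s + ν ≠ 0 := by positivity
  have h2 : μ + Real.sqrt s ≠ 0 := by positivity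
  have h3 : 1 + Real.sqrt s ≠ 0 := by positivity
  rw [claimLT]
  field_simp
  ring

theorem tendsto_one_sub_claimLT_div {μ ν : ℝ} (ε : ℝ) (hμ : 0 < μ) (hν : 0 < ν) :
    Tendsto (fun s => (1 - claimLT μ ν ε s) / s) (𝓝[>] 0)
      (𝓝 ((μ + ε * (ν - μ)) / (μ * ν))) := by
  have hc : ContinuousAt (fun s =>
      (1 - ε) / (s + ν) + ε / ((μ + Real.sqrt s) * (1 + Real.sqrt s))) 0 := by
    refine ContinuousAt.add (ContinuousAt.div (by fun_prop) (by fun_prop) (by simpa using hν.ne'))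
      (ContinuousAt.div (by fun_prop) (by fun_prop) (by simpa using hμ.ne'))
  have h0 : (1 - ε) / (0 + ν) + ε / ((μ + Real.sqrt 0) * (1 + Real.sqrt 0)) =
      (μ + ε * (ν - μ)) / (μ * ν) := by
    simp
    field_simp
    ring
  have h1 := hc.tendsto
  rw [h0] at h1
  refine (h1.mono_left nhdsWithin_le_nhds).congr' ?_
  filter_upwards [self_mem_nhdsWithin] with s hs
  exact (one_sub_claimLT_div ε hμ hν hs).symm

theorem tendsto_one_sub_integral_exp_div {μ ν ε : ℝ} {G : Measure ℝ} (hμ : 0 < μ) (hν : 0 < ν)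
    (hLT : ∀ s : ℝ, 0 < s → ∫ x, Real.exp (-s * x) ∂G = claimLT μ ν ε s) :
    Tendsto (fun s => (1 - ∫ x, Real.exp (-s * x) ∂G) / s) (𝓝[>] 0)
      (𝓝 ((μ + ε * (ν - μ)) / (μ * ν))) := by
  refine (tendsto_one_sub_claimLT_div ε hμ hν).congr' ?_
  filter_upwards [self_mem_nhdsWithin] with s hs
  rw [hLT s hs]

/-- The Pollaczek–Khinchine formula for claims with mean `m`. The constant in
`integral_exp_walkSup_mul` is identified by letting `s` tend to zero. -/
theorem IsCramerLundberg.integral_exp_walkSup_mul_eq {Ω : Type*} [MeasurableSpace Ω]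
    {P : Measure Ω} [IsProbabilityMeasure P] {lam : ℝ} {G : Measure ℝ} {τ U : ℕ → Ω → ℝ}
    (h : IsCramerLundberg P lam G τ U) (hlam : 0 < lam) {m : ℝ}
    (hm : Tendsto (fun s => (1 - ∫ x, Real.exp (-s * x) ∂G) / s) (𝓝[>] 0) (𝓝 m))
    (hload : lam * m < 1) {s : ℝ} (hs : 0 < s) (hne : s ≠ lam) :
    (∫ ω, Real.exp (-s * walkSup fun i => U i ω - τ i ω) ∂P) *
        (1 - lam * ((1 - ∫ x, Real.exp (-s * x) ∂G) / s)) = 1 - lam * m := by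
  have := h.isProbabilityMeasure_claim
  obtain ⟨hG, hmean⟩ := integrable_of_tendsto_one_sub_integral_exp h.ae_nonneg hm
  set K := ∫ ω, Real.exp (-lam * (U 0 ω + walkSup fun i => U (i + 1) ω - τ (i + 1) ω)) ∂P
  have hK : ∀ s, 0 < s → s ≠ lam →
      (∫ ω, Real.exp (-s * walkSup fun i => U i ω - τ i ω) ∂P) *
        (1 - lam * ((1 - ∫ x, Real.exp (-s * x) ∂G) / s)) = K := by
    intro s hs hne
    have := h.integral_exp_walkSup_mul hlam hG (by rwa [hmean]) hs hne
    have hs' := hs.ne'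
    generalize (∫ ω, Real.exp (-s * walkSup fun i => U i ω - τ i ω) ∂P) = A at *
    generalize (∫ x, Real.exp (-s * x) ∂G) = B at *
    field_simp
    linear_combination this
  rw [hK s hs hne]
  have hlim := h.tendsto_integral_exp_walkSup.mul ((hm.const_mul lam).const_sub 1)
  rw [one_mul] at hlim
  refine tendsto_nhds_unique (tendsto_const_nhds.congr' ?_) hlim
  filter_upwards [Ioo_mem_nhdsGT hlam] with s hs
  exact (hK s hs.1 hs.2.ne).symm

/-! ### Partial fractions -/

theorem eval_denPoly (lam μ ν ε : ℝ) (x : ℂ) :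
    (denPoly lam μ ν ε).eval x =
      (x ^ 2 + ν) * (μ + x) * (1 + x) - lam * (numPoly μ ν ε).eval x := by
  simp only [denPoly, numPoly, eval_add, eval_mul, eval_pow, eval_X, eval_C, eval_one]
  push_cast
  ring

theorem eval_numPoly (μ ν ε : ℝ) (x : ℂ) :
    (numPoly μ ν ε).eval x = (1 - ε) * (μ + x) * (1 + x) + ε * (x ^ 2 + ν) := by
  simp [numPoly]

theorem monic_denPoly (lam μ ν ε : ℝ) : (denPoly lam μ ν ε).Monic := by
  rw [denPoly]
  monicity!

theorem degree_numPoly_lt (μ ν ε : ℝ) : (numPoly μ ν ε).degree < 4 := by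
  have : (numPoly μ ν ε).degree ≤ 2 := by
    rw [numPoly]
    compute_degree
  exact this.trans_lt (by norm_num)

section Roots

variable {lam μ ν ε : ℝ} {r : Fin 4 → ℂ}

theorem eval_denPoly_eq_prod
    (hr : (denPoly lam μ ν ε).roots = Finset.univ.val.map (fun i => -r i)) (x : ℂ) :
    (denPoly lam μ ν ε).eval x = ∏ i, (x + r i) := by
  have h := (IsAlgClosed.splits (denPoly lam μ ν ε)).eq_prod_roots_of_monic (monic_denPoly _ _ _ _)
  rw [hr, Multiset.map_map] at h
  rw [h, eval_multiset_prod, Multiset.map_map]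
  simp [Fin.prod_univ_four, mul_assoc]

theorem tendsto_residue_of_injective
    (hr : (denPoly lam μ ν ε).roots = Finset.univ.val.map (fun i => -r i))
    (hinj : Function.Injective r) (i : Fin 4) :
    Tendsto (fun x : ℂ => (numPoly μ ν ε).eval x / (denPoly lam μ ν ε).eval x * (x + r i))
      (𝓝[≠] (-r i))
      (𝓝 ((numPoly μ ν ε).eval (-r i) / ∏ j ∈ Finset.univ.erase i, (-r i + r j))) := by
  have hc : ContinuousAt (fun x : ℂ =>
      (numPoly μ ν ε).eval x / ∏ j ∈ Finset.univ.erase i, (x + r j)) (-r i) := by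
    refine ContinuousAt.div (by fun_prop) (by fun_prop) ?_
    refine Finset.prod_ne_zero_iff.2 fun j hj h0 => Finset.ne_of_mem_erase hj (hinj ?_)
    linear_combination h0
  refine (hc.tendsto.mono_left nhdsWithin_le_nhds).congr' ?_
  filter_upwards [self_mem_nhdsWithin] with x hx
  have hx' : x + r i ≠ 0 := fun h0 => hx (eq_neg_of_add_eq_zero_left h0)
  rw [eval_denPoly_eq_prod hr, ← Finset.mul_prod_erase _ _ (Finset.mem_univ i)]
  field_simp

theorem eventually_eval_ne_zero {p : ℂ[X]} (hp : p ≠ 0) (t : ℂ) :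
    ∀ᶠ x in 𝓝[≠] t, p.eval x ≠ 0 := by
  have hfin : ((p.roots.toFinset : Set ℂ) \ {t}).Finite := (Finset.finite_toSet _).sdiff
  have hmem : ((p.roots.toFinset : Set ℂ) \ {t})ᶜ ∈ 𝓝 t :=
    hfin.isClosed.isOpen_compl.mem_nhds (by simp)
  filter_upwards [mem_nhdsWithin_of_mem_nhds hmem, self_mem_nhdsWithin] with x hx hxt h0
  exact hx ⟨by simpa [hp] using h0, hxt⟩

/-- If `n / d` has at most a simple pole at a multiple root of `d`, then `n` vanishes there. -/
theorem eval_eq_zero_of_tendsto_of_double_root {n d : ℂ[X]} (hd : d ≠ 0) {t a : ℂ}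
    (h0 : d.eval t = 0) (h1 : d.derivative.eval t = 0)
    (ha : Tendsto (fun x => n.eval x / d.eval x * (x - t)) (𝓝[≠] t) (𝓝 a)) : n.eval t = 0 := by
  have hslope : Tendsto (fun x => d.eval x / (x - t)) (𝓝[≠] t) (𝓝 0) := by
    have := hasDerivAt_iff_tendsto_slope.1 (d.hasDerivAt t)
    rw [h1] at this
    refine this.congr fun x => ?_
    rw [slope_def_field, h0, sub_zero]
  have hprod := ha.mul hslope
  rw [mul_zero] at hprod
  have hn : Tendsto (fun x => n.eval x) (𝓝[≠] t) (𝓝 (n.eval t)) :=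
    (n.continuous.tendsto t).mono_left nhdsWithin_le_nhds
  refine tendsto_nhds_unique hn (hprod.congr' ?_)
  filter_upwards [eventually_eval_ne_zero hd t, self_mem_nhdsWithin] with x hx hxt
  have : x - t ≠ 0 := sub_ne_zero.2 hxt
  field_simp

/-- A common root of `n` and `d` is a root of `(x ^ 2 + ν) * (μ + x) * (1 + x)`, and then
`ε = 1` (for a root of `x ^ 2 + ν`) or `ε = 0`. In both cases `d` factors explicitly, and only
`ε = 0`, `μ = 1` allows the root to be multiple. -/
theorem eq_zero_and_eq_one_of_common_double_root (hμ : 0 < μ) (hν : 0 < ν)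
    (hρ : load lam μ ν ε < 1) {t : ℂ}
    (h0 : (denPoly lam μ ν ε).eval t = 0) (h1 : (denPoly lam μ ν ε).derivative.eval t = 0)
    (hn : (numPoly μ ν ε).eval t = 0) : ε = 0 ∧ μ = 1 := by
  rw [eval_denPoly, hn, mul_zero, sub_zero, mul_assoc] at h0
  rw [eval_numPoly] at hn
  have h1' : 4 * t ^ 3 + 3 * (μ + 1) * t ^ 2 + 2 * (μ + ν - lam) * t +
      (μ + 1) * (ν - lam + lam * ε) = 0 := by
    rw [← h1, denPoly]
    simp
    ring
  have hreal : ∀ y : ℝ, t ≠ y ∨ t ^ 2 + ν ≠ 0 := by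
    intro y
    by_contra hcon
    push Not at hcon
    obtain ⟨rfl, h2⟩ := hcon
    have : y ^ 2 + ν = 0 := by exact_mod_cast h2
    nlinarith [sq_nonneg y]
  rcases mul_eq_zero.1 h0 with hq | hlin
  · exfalso
    have hs := fun y => (hreal y).resolve_right (not_not.2 hq)
    rw [hq, mul_zero, add_zero, mul_assoc] at hn
    have hε : ε = 1 := by
      rcases mul_eq_zero.1 hn with h | h
      · have : (1 : ℂ) = ε := sub_eq_zero.1 h
        exact_mod_cast this.symm
      · rcases mul_eq_zero.1 h with h | h
        · exact absurd (by push_cast; linear_combination h) (hs (-μ))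
        · exact absurd (by push_cast; linear_combination h) (hs (-1))
    subst hε
    have ht0 : t ≠ 0 := by simpa using hs 0
    -- the derivative at `t` is `2 t ((μ + t) (1 + t) - λ)`
    have h3 : t * ((μ + 1) * t + (μ - ν - lam)) = 0 := by
      push_cast at h1'
      linear_combination h1' / 2 - (2 * t + 3 / 2 * (μ + 1) - (μ + 1)) * hq
    have h4 := (mul_eq_zero.1 h3).resolve_left ht0
    have hμ1 : ((μ : ℂ) + 1) ≠ 0 := by exact_mod_cast (by positivity : μ + 1 ≠ 0)
    refine hs ((lam + ν - μ) / (μ + 1)) ?_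
    push_cast
    rw [eq_div_iff hμ1]
    linear_combination h4
  · have hlin' : (1 - (ε : ℂ)) * (μ + t) * (1 + t) = 0 := by rw [mul_assoc, hlin, mul_zero]
    rw [hlin', zero_add] at hn
    have hreal2 : ∃ y : ℝ, t = y ∧ (y = -μ ∨ y = -1) := by
      rcases mul_eq_zero.1 hlin with h | h
      · exact ⟨-μ, by push_cast; linear_combination h, Or.inl rfl⟩
      · exact ⟨-1, by push_cast; linear_combination h, Or.inr rfl⟩
    obtain ⟨y, rfl, hy⟩ := hreal2
    have hε : ε = 0 := by
      have := (mul_eq_zero.1 hn).resolve_right ((hreal y).resolve_left (not_not.2 rfl))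
      exact_mod_cast this
    subst hε
    have hlt : lam < ν := by
      rw [load, zero_mul, add_zero, div_mul_eq_mul_div, div_lt_one (by positivity)] at hρ
      nlinarith
    have h1r : 4 * y ^ 3 + 3 * (μ + 1) * y ^ 2 + 2 * (μ + ν - lam) * y +
      (μ + 1) * (ν - lam + lam * 0) = 0 := by exact_mod_cast h1'
    refine ⟨rfl, ?_⟩
    rcases hy with rfl | rfl
    · have : (μ ^ 2 + (ν - lam)) * (1 - μ) = 0 := by linear_combination h1r
      rcases mul_eq_zero.1 this with h | h
      · nlinarith [sq_nonneg μ]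
      · linarith
    · have : (1 + (ν - lam)) * (μ - 1) = 0 := by linear_combination h1r
      rcases mul_eq_zero.1 this with h | h
      · linarith
      · linarith

/-- Partial fractions for simple roots, by Lagrange interpolation of `n` at the roots of `d`. -/
theorem sum_residue_div_of_injective
    (hr : (denPoly lam μ ν ε).roots = Finset.univ.val.map (fun i => -r i))
    (hinj : Function.Injective r) {a : Fin 4 → ℂ} (ha : IsResidueFamily lam μ ν ε r a) {x : ℂ}
    (hx : (denPoly lam μ ν ε).eval x ≠ 0) :
    (numPoly μ ν ε).eval x / (denPoly lam μ ν ε).eval x = ∑ i, a i / (x + r i) := by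
  have hne : ∀ i, x + r i ≠ 0 := fun i => by
    rw [eval_denPoly_eq_prod hr] at hx
    exact Finset.prod_ne_zero_iff.1 hx i (Finset.mem_univ i)
  have hinj' : Set.InjOn (fun i => -r i) (Finset.univ : Finset (Fin 4)) := fun i _ j _ hij =>
    hinj (neg_injective hij)
  have hL := Lagrange.eq_interpolate hinj' (f := numPoly μ ν ε) (by
    simpa using degree_numPoly_lt μ ν ε)
  have hE := congrArg (eval x) hL
  rw [Lagrange.eval_interpolate_not_at_node _ fun i _ h =>
    hne i (by rw [h]; ring), Lagrange.eval_nodal] at hE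
  simp only [sub_neg_eq_add] at hE
  rw [hE, ← eval_denPoly_eq_prod hr, mul_div_cancel_left₀ _ hx]
  refine Finset.sum_congr rfl fun i _ => ?_
  rw [tendsto_nhds_unique (ha i) (tendsto_residue_of_injective hr hinj i), Lagrange.nodalWeight,
    Finset.prod_inv_distrib]
  simp only [sub_neg_eq_add]
  ring

/-- For `ε = 0` and `μ = 1` one has `n = (x + 1) ^ 2` and `d = (x + 1) ^ 2 * (x ^ 2 + ν - lam)`:
the root `-1` is listed twice, both times with `a i = 0`. -/
theorem sum_residue_div_of_double_root {lam ν : ℝ} (hlt : lam < ν)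
    (hr : (denPoly lam 1 ν 0).roots = Finset.univ.val.map (fun i => -r i))
    {a : Fin 4 → ℂ} (ha : IsResidueFamily lam 1 ν 0 r a) {x : ℂ}
    (hx : (denPoly lam 1 ν 0).eval x ≠ 0) :
    (numPoly 1 ν 0).eval x / (denPoly lam 1 ν 0).eval x = ∑ i, a i / (x + r i) := by
  obtain ⟨w, hw, hw0, hw1⟩ : ∃ w : ℂ, w ^ 2 = ((lam - ν : ℝ) : ℂ) ∧ w ≠ 0 ∧ w ^ 2 ≠ 1 := by
    obtain ⟨w, hw⟩ := IsAlgClosed.exists_pow_nat_eq ((lam - ν : ℝ) : ℂ) two_pos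
    refine ⟨w, hw, ?_, ?_⟩
    · rintro rfl
      rw [zero_pow two_ne_zero] at hw
      have : (0 : ℝ) = lam - ν := by exact_mod_cast hw
      linarith
    · rw [hw]
      intro h
      have : lam - ν = 1 := by exact_mod_cast h
      linarith
  have hfac : denPoly lam 1 ν 0 = (({-1, -1, w, -w} : Multiset ℂ).map fun c => X - C c).prod := by
    have hc : (C w : ℂ[X]) ^ 2 = C ((lam - ν : ℝ) : ℂ) := by rw [← hw, C_pow]
    simp only [denPoly, Multiset.insert_eq_cons, Multiset.map_cons, Multiset.prod_cons,
      Multiset.map_singleton, Multiset.prod_singleton]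
    simp only [Complex.ofReal_sub, Complex.ofReal_add, Complex.ofReal_mul, Complex.ofReal_one,
      Complex.ofReal_zero, C_add, C_sub, C_mul, C_1, C_neg, C_0] at hc ⊢
    linear_combination (X + 1) ^ 2 * hc
  have hroots : Finset.univ.val.map (fun i => -r i) = ({-1, -1, w, -w} : Multiset ℂ) := by
    rw [← hr, hfac, roots_multiset_prod_X_sub_C]
  have hden : ∀ z, (denPoly lam 1 ν 0).eval z = (z + 1) ^ 2 * (z ^ 2 - w ^ 2) := fun z => by
    rw [eval_denPoly, eval_numPoly, hw]; push_cast; ring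
  have hnum : ∀ z, (numPoly 1 ν 0).eval z = (z + 1) ^ 2 := fun z => by
    rw [eval_numPoly]; push_cast; ring
  -- the residue at a root `c` of `d`
  let F : ℂ → ℂ := fun c => if c = -1 then 0 else 1 / (2 * c)
  have haF : ∀ i, a i = F (-r i) := by
    intro i
    have hmem : -r i ∈ ({-1, -1, w, -w} : Multiset ℂ) := by
      rw [← hroots]; exact Multiset.mem_map_of_mem _ (Finset.mem_univ i)
    refine tendsto_nhds_unique (ha i) ?_
    obtain ⟨c, hc⟩ : ∃ c, c = -r i := ⟨_, rfl⟩
    rw [← hc] at hmem ⊢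
    have hri : r i = -c := by rw [hc, neg_neg]
    simp only [hden, hnum, hri]
    by_cases hc1 : c = -1
    · subst hc1
      have hcont : ContinuousAt (fun z : ℂ => (z + 1) / (z ^ 2 - w ^ 2)) (-1) :=
        ContinuousAt.div (by fun_prop) (by fun_prop) (by
          rw [sub_ne_zero]; simpa using hw1.symm)
      have := hcont.tendsto
      simp only [neg_add_cancel, zero_div] at this
      simp only [F, if_true]
      refine (this.mono_left nhdsWithin_le_nhds).congr' ?_
      filter_upwards [self_mem_nhdsWithin] with z hz
      have : z + 1 ≠ 0 := fun h => hz (eq_neg_of_add_eq_zero_left h)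
      field_simp
    · have hcw : c ^ 2 = w ^ 2 ∧ c ≠ 0 := by
        simp only [Multiset.insert_eq_cons, Multiset.mem_cons, Multiset.mem_singleton] at hmem
        rcases hmem with h | h | h | h
        · exact absurd h hc1
        · exact absurd h hc1
        · exact ⟨by rw [h], by rwa [h]⟩
        · exact ⟨by rw [h, neg_sq], by rw [h]; exact neg_ne_zero.2 hw0⟩
      have hcont : ContinuousAt (fun z : ℂ => 1 / (z + c)) c :=
        ContinuousAt.div (by fun_prop) (by fun_prop) (by
          rw [← two_mul]; exact mul_ne_zero two_ne_zero hcw.2)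
      have := hcont.tendsto
      simp only [← two_mul] at this
      simp only [F, if_neg hc1]
      refine (this.mono_left nhdsWithin_le_nhds).congr' ?_
      have hev : ∀ᶠ z in 𝓝[≠] c, z + 1 ≠ 0 ∧ z + c ≠ 0 := by
        refine (Filter.Eventually.filter_mono nhdsWithin_le_nhds ?_)
        refine (ContinuousAt.eventually_ne (by fun_prop) ?_).and
          (ContinuousAt.eventually_ne (by fun_prop) ?_)
        · exact fun h => hc1 (eq_neg_of_add_eq_zero_left h)
        · rw [← two_mul]; exact mul_ne_zero two_ne_zero hcw.2
      filter_upwards [hev, self_mem_nhdsWithin] with z hz hzc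
      have h1 := hz.1
      have h2 := hz.2
      have h3 : z - c ≠ 0 := sub_ne_zero.2 hzc
      rw [← hcw.1, show z ^ 2 - c ^ 2 = (z + c) * (z - c) by ring, ← sub_eq_add_neg]
      field_simp
  have hsum : ∑ i, a i / (x + r i) =
      (({-1, -1, w, -w} : Multiset ℂ).map fun c => F c / (x - c)).sum := by
    rw [← hroots, Multiset.map_map]
    simp [haF, Finset.sum]
  have hwm : w ≠ -1 := by rintro rfl; simp at hw1
  have hwm' : -w ≠ -1 := by
    intro h
    rw [neg_inj] at h
    simp [h] at hw1
  rw [hsum, hden, hnum]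
  rw [hden] at hx
  have hx1 : x + 1 ≠ 0 := fun h => hx (by rw [h]; ring)
  have hx2 : x - w ≠ 0 := fun h => hx (by linear_combination (x + 1) ^ 2 * (x + w) * h)
  have hx3 : x + w ≠ 0 := fun h => hx (by linear_combination (x + 1) ^ 2 * (x - w) * h)
  have hx4 : x ^ 2 - w ^ 2 ≠ 0 := right_ne_zero_of_mul hx
  simp only [Multiset.insert_eq_cons, Multiset.map_cons, Multiset.sum_cons,
      Multiset.map_singleton, Multiset.sum_singleton, F, if_true, if_neg hwm, if_neg hwm']
  rw [sub_neg_eq_add x w, div_eq_iff hx, show x ^ 2 - w ^ 2 = (x - w) * (x + w) by ring]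
  field_simp
  ring

/-- Partial fraction expansion of `n / d`, valid whenever the limits `a i` exist. -/
theorem sum_residue_div (hμ : 0 < μ) (hν : 0 < ν)
    (hρ : load lam μ ν ε < 1)
    (hr : (denPoly lam μ ν ε).roots = Finset.univ.val.map (fun i => -r i))
    {a : Fin 4 → ℂ} (ha : IsResidueFamily lam μ ν ε r a) {x : ℂ}
    (hx : (denPoly lam μ ν ε).eval x ≠ 0) :
    (numPoly μ ν ε).eval x / (denPoly lam μ ν ε).eval x = ∑ i, a i / (x + r i) := by
  have hd0 := (monic_denPoly lam μ ν ε).ne_zero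
  by_cases hinj : Function.Injective r
  · exact sum_residue_div_of_injective hr hinj ha hx
  · have hnodup : ¬ (denPoly lam μ ν ε).roots.Nodup := by
      rw [hr]
      intro h
      refine hinj fun i j hij => Multiset.inj_on_of_nodup_map h i (Finset.mem_univ i) j
        (Finset.mem_univ j) (by rw [hij])
    rw [Multiset.nodup_iff_count_le_one] at hnodup
    push Not at hnodup
    obtain ⟨t, ht⟩ := hnodup
    have hmem : t ∈ (denPoly lam μ ν ε).roots := Multiset.count_pos.1 (by omega)
    rw [count_roots, one_lt_rootMultiplicity_iff_isRoot hd0] at ht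
    rw [hr, Multiset.mem_map] at hmem
    obtain ⟨i, -, rfl⟩ := hmem
    have hn := eval_eq_zero_of_tendsto_of_double_root hd0 ht.1 ht.2
      (by simpa only [sub_neg_eq_add] using ha i)
    obtain ⟨rfl, rfl⟩ := eq_zero_and_eq_one_of_common_double_root hμ hν hρ ht.1 ht.2 hn
    refine sum_residue_div_of_double_root ?_ hr ha hx
    rw [load, zero_mul, add_zero, mul_one, one_mul, div_lt_one hν] at hρ
    exact hρ

theorem eval_zero_denPoly (hμ : 0 < μ) (hν : 0 < ν) :
    (denPoly lam μ ν ε).eval 0 = ((μ * ν * (1 - load lam μ ν ε) : ℝ) : ℂ) := by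
  have : μ * ν * (1 - load lam μ ν ε) = μ * ν - lam * (μ + ε * (ν - μ)) := by
    rw [load]; field_simp
  rw [this, eval_denPoly, eval_numPoly]
  push_cast
  ring

end Roots

/-! ### The ruin probability -/

/-- The Laplace transform of the ruin probability as a combination of Laplace transforms of the
functions `expErfc (r i)`. -/
theorem IsCramerLundberg.one_sub_integral_exp_walkSup_div {Ω : Type*} [MeasurableSpace Ω]
    {P : Measure Ω} [IsProbabilityMeasure P] {lam μ ν ε : ℝ} {G : Measure ℝ} {τ U : ℕ → Ω → ℝ}
    (h : IsCramerLundberg P lam G τ U) (hlam : 0 < lam) (hμ : 0 < μ) (hν : 0 < ν)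
    (hLT : ∀ s : ℝ, 0 < s → ∫ x, Real.exp (-s * x) ∂G = claimLT μ ν ε s)
    (hρ : load lam μ ν ε < 1) {r : Fin 4 → ℂ}
    (hr : (denPoly lam μ ν ε).roots = Finset.univ.val.map (fun i => -r i))
    {a : Fin 4 → ℂ} (ha : IsResidueFamily lam μ ν ε r a) {s : ℝ} (hs : 0 < s) (hne : s ≠ lam) :
    (((1 - ∫ ω, Real.exp (-s * walkSup fun i => U i ω - τ i ω) ∂P) / s : ℝ) : ℂ) =
      ((lam / (μ * ν) * (μ * ν - lam * (μ + ε * (ν - μ))) : ℝ) : ℂ) *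
        ∑ i, a i / r i * (1 / ((Real.sqrt s : ℂ) * (Real.sqrt s + r i))) := by
  have hm := tendsto_one_sub_integral_exp_div hμ hν hLT
  have hloadm : lam * ((μ + ε * (ν - μ)) / (μ * ν)) = load lam μ ν ε := by rw [load]; ring
  have hPK := h.integral_exp_walkSup_mul_eq hlam hm (by rwa [hloadm]) hs hne
  rw [hloadm, hLT s hs, one_sub_claimLT_div ε hμ hν hs] at hPK
  have hconst : lam / (μ * ν) * (μ * ν - lam * (μ + ε * (ν - μ))) =
      lam * (1 - load lam μ ν ε) := by rw [load]; field_simp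
  rw [hconst]
  set m := ∫ ω, Real.exp (-s * walkSup fun i => U i ω - τ i ω) ∂P
  set ρ := load lam μ ν ε with hρdef
  have hx0 : 0 < Real.sqrt s := Real.sqrt_pos.2 hs
  have hsx : s = Real.sqrt s ^ 2 := (Real.sq_sqrt hs.le).symm
  set x := Real.sqrt s
  rw [hsx] at hPK ⊢
  have hPKc := congrArg (fun y : ℝ => (y : ℂ)) hPK
  push_cast at hPKc
  have hxc : (x : ℂ) ≠ 0 := by exact_mod_cast hx0.ne'
  have hA : (x : ℂ) ^ 2 + ν ≠ 0 := by exact_mod_cast (by positivity : x ^ 2 + ν ≠ 0)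
  have hB : (μ : ℂ) + x ≠ 0 := by exact_mod_cast (by positivity : μ + x ≠ 0)
  have hC : (1 : ℂ) + x ≠ 0 := by exact_mod_cast (by positivity : 1 + x ≠ 0)
  have hρc : (1 : ℂ) - ρ ≠ 0 := by exact_mod_cast (sub_pos.2 hρ).ne'
  have hD := eval_denPoly lam μ ν ε (x : ℂ)
  have hN := eval_numPoly μ ν ε (x : ℂ)
  have hkey : (m : ℂ) * (denPoly lam μ ν ε).eval (x : ℂ) =
      (1 - ρ) * ((x ^ 2 + ν) * (μ + x) * (1 + x)) := by
    rw [hD, hN, ← hPKc]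
    field_simp
  have hDne : (denPoly lam μ ν ε).eval (x : ℂ) ≠ 0 := by
    intro h0
    rw [h0, mul_zero] at hkey
    exact mul_ne_zero hρc (mul_ne_zero (mul_ne_zero hA hB) hC) hkey.symm
  have hD0 := eval_zero_denPoly (lam := lam) (ε := ε) hμ hν
  have hμν : (μ : ℂ) * ν ≠ 0 := by exact_mod_cast (mul_pos hμ hν).ne'
  have hD0ne : (denPoly lam μ ν ε).eval (0 : ℂ) ≠ 0 := by
    rw [hD0, ← hρdef]
    push_cast
    exact mul_ne_zero hμν hρc
  have hrne : ∀ i, r i ≠ 0 := fun i h0 => hD0ne (by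
    rw [eval_denPoly_eq_prod hr]
    exact Finset.prod_eq_zero (Finset.mem_univ i) (by rw [h0, add_zero]))
  have hxrne : ∀ i, (x : ℂ) + r i ≠ 0 := fun i h0 => hDne (by
    rw [eval_denPoly_eq_prod hr]
    exact Finset.prod_eq_zero (Finset.mem_univ i) h0)
  have hpf := sum_residue_div hμ hν hρ hr ha hDne
  have hpf0 := sum_residue_div hμ hν hρ hr ha hD0ne
  simp only [zero_add] at hpf0
  have hsum : ∑ i, a i / r i * (1 / ((x : ℂ) * (x + r i))) =
      (∑ i, a i / r i - ∑ i, a i / (x + r i)) / x ^ 2 := by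
    rw [← Finset.sum_sub_distrib, Finset.sum_div]
    refine Finset.sum_congr rfl fun i _ => ?_
    have h1 := hrne i
    have h2 := hxrne i
    field_simp
    ring
  -- the value at zero of `n / d` encodes the load
  have hzero : (lam : ℂ) * (1 - ρ) *
      ((numPoly μ ν ε).eval 0 / (denPoly lam μ ν ε).eval 0) = ρ := by
    have hN0 : (lam : ℂ) * (numPoly μ ν ε).eval 0 = μ * ν * ρ := by
      have := eval_denPoly lam μ ν ε 0
      rw [hD0, ← hρdef] at this
      push_cast at this
      linear_combination this
    rw [hD0, ← hρdef]
    push_cast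
    rw [← mul_div_assoc, div_eq_iff (mul_ne_zero hμν hρc)]
    linear_combination (1 - (ρ : ℂ)) * hN0
  rw [hsum, ← hpf, ← hpf0]
  push_cast
  rw [← mul_div_assoc, mul_sub, hzero]
  congr 1
  field_simp
  linear_combination -hkey + (1 - (ρ : ℂ)) * hD

end RiskModel

theorem theoremt {Ω : Type*} [MeasurableSpace Ω] (P : Measure Ω) [IsProbabilityMeasure P]
    (lam μ ν ε : ℝ) (hlam : 0 < lam) (hμ : 0 < μ) (hν : 0 < ν) (hε : ε ∈ Set.Icc (0 : ℝ) 1)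
    (G : Measure ℝ) (τ U : ℕ → Ω → ℝ)
    (hmodel : RiskModel.IsCramerLundberg P lam G τ U)
    (hLT : ∀ s : ℝ, 0 < s → ∫ x, Real.exp (-s * x) ∂G = RiskModel.claimLT μ ν ε s)
    (hρ : RiskModel.load lam μ ν ε < 1)
    (r : Fin 4 → ℂ)
    (hr : (RiskModel.denPoly lam μ ν ε).roots = Finset.univ.val.map (fun i => -r i)) :
    (Integrable (fun x : ℝ => x) G ∧ lam * ∫ x, x ∂G = RiskModel.load lam μ ν ε) ∧
    (∀ i, r i ≠ 0) ∧
    (Function.Injective r → ∃ a : Fin 4 → ℂ, RiskModel.IsResidueFamily lam μ ν ε r a) ∧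
    ∀ a : Fin 4 → ℂ, RiskModel.IsResidueFamily lam μ ν ε r a → ∀ u : ℝ, 0 ≤ u →
      (RiskModel.ruinProb P τ U u : ℂ) =
        ((lam / (μ * ν) * (μ * ν - lam * (μ + ε * (ν - μ))) : ℝ) : ℂ) *
          ∑ i, a i / r i *
            (Complex.exp (r i ^ 2 * (u : ℂ)) * RiskModel.erfc (r i * (Real.sqrt u : ℂ))) := by
  have := hmodel.isProbabilityMeasure_claim
  have hm := RiskModel.tendsto_one_sub_integral_exp_div hμ hν hLT
  obtain ⟨hG, hmean⟩ := RiskModel.integrable_of_tendsto_one_sub_integral_exp hmodel.ae_nonneg hm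
  have hload : lam * ∫ x, x ∂G = RiskModel.load lam μ ν ε := by
    rw [hmean, RiskModel.load]; ring
  refine ⟨⟨hG, hload⟩, fun i h0 => ?_,
    fun hinj => ⟨_, fun i => RiskModel.tendsto_residue_of_injective hr hinj i⟩, ?_⟩
  · have h1 := RiskModel.eval_zero_denPoly (lam := lam) (ε := ε) hμ hν
    rw [RiskModel.eval_denPoly_eq_prod hr, Finset.prod_eq_zero (Finset.mem_univ i) (by
      rw [h0, add_zero])] at h1
    have h2 : (0 : ℝ) = μ * ν * (1 - RiskModel.load lam μ ν ε) := by exact_mod_cast h1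
    exact (mul_pos (mul_pos hμ hν) (sub_pos.2 hρ)).ne h2
  · intro a ha u hu
    set c : ℂ := ((lam / (μ * ν) * (μ * ν - lam * (μ + ε * (ν - μ))) : ℝ) : ℂ)
    set M : Ω → ℝ := fun ω => RiskModel.walkSup fun i => U i ω - τ i ω with hM
    have hMm : Measurable M := hmodel.measurable_walkSup
    set ψ : ℝ → ℝ := fun u => P.real {ω | u < M ω} with hψ
    have hψr : ∀ u, RiskModel.ruinProb P τ U u = ψ u :=
      hmodel.ruinProb_eq hlam hG (by rwa [hload])
    -- for `s ≥ S` all Laplace transforms converge and `s ≠ lam`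
    set S : ℝ := lam + 1 + ∑ i, (2 * ‖r i‖ ^ 2 + 2) with hS
    have hSi : ∀ i, 2 * ‖r i‖ ^ 2 + 2 ≤ S := fun i => by
      have := Finset.single_le_sum (f := fun i => 2 * ‖r i‖ ^ 2 + 2)
        (fun i _ => by positivity) (Finset.mem_univ i)
      linarith
    have hSlam : lam < S := by
      have : 0 ≤ ∑ i, (2 * ‖r i‖ ^ 2 + 2) := Finset.sum_nonneg fun i _ => by positivity
      linarith
    have hanti : Antitone ψ := fun a b hab =>
      measureReal_mono fun ω (hω : b < M ω) => lt_of_le_of_lt hab hω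
    set h : ℝ → ℂ := fun u => (ψ u : ℂ) - c * ∑ i, a i / r i * RiskModel.expErfc (r i) u with hh
    have hψint : ∀ s, S ≤ s →
        IntegrableOn (fun u => Real.exp (-(s * u)) • (ψ u : ℂ)) (Set.Ioi 0) := by
      intro s hs
      have hs0 : 0 < s := hlam.trans (hSlam.trans_le hs)
      have hdom : IntegrableOn (fun u : ℝ => Real.exp (-s * u)) (Set.Ioi 0) :=
        exp_neg_integrableOn_Ioi 0 hs0
      refine hdom.mono' ?_ ?_
      · have h1 : Measurable fun u => Real.exp (-(s * u)) := by fun_prop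
        have h2 : Measurable fun u => (ψ u : ℂ) :=
          Complex.continuous_ofReal.measurable.comp hanti.measurable
        exact (h1.smul h2).aestronglyMeasurable
      · refine Eventually.of_forall fun u => ?_
        rw [norm_smul, Complex.norm_real, Real.norm_of_nonneg (Real.exp_pos _).le,
          Real.norm_of_nonneg measureReal_nonneg, ← neg_mul]
        exact mul_le_of_le_one_right (Real.exp_pos _).le measureReal_le_one
    have hsplit : ∀ s u, Real.exp (-(s * u)) • h u = Real.exp (-(s * u)) • (ψ u : ℂ) -
        c * ∑ i, a i / r i * (Real.exp (-(s * u)) • RiskModel.expErfc (r i) u) := by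
      intro s u
      simp only [hh, smul_sub, Complex.real_smul, Finset.mul_sum]
      congr 1
      exact Finset.sum_congr rfl fun i _ => by ring
    have hterm : ∀ s, S ≤ s → ∀ i ∈ Finset.univ, IntegrableOn
        (fun u => a i / r i * (Real.exp (-(s * u)) • RiskModel.expErfc (r i) u)) (Set.Ioi 0) :=
      fun s hs i _ => (RiskModel.integrableOn_exp_smul_expErfc (r i) ((hSi i).trans hs)).const_mul _
    have hsumint : ∀ s, S ≤ s → IntegrableOn (fun u => c * ∑ i, a i / r i *
        (Real.exp (-(s * u)) • RiskModel.expErfc (r i) u)) (Set.Ioi 0) :=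
      fun s hs => (integrable_finsetSum _ (hterm s hs)).const_mul c
    have hhint : ∀ s, S ≤ s → IntegrableOn (fun u => Real.exp (-(s * u)) • h u) (Set.Ioi 0) := by
      intro s hs
      simp_rw [hsplit]
      exact (hψint s hs).sub (hsumint s hs)
    have hhzero : ∀ s, S ≤ s → ∫ u in Set.Ioi (0 : ℝ), Real.exp (-(s * u)) • h u = 0 := by
      intro s hs
      have hs0 : 0 < s := hlam.trans (hSlam.trans_le hs)
      simp_rw [hsplit]
      rw [integral_sub (hψint s hs) (hsumint s hs), integral_const_mul,
        integral_finsetSum _ (hterm s hs)]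
      simp_rw [integral_const_mul]
      rw [Finset.sum_congr rfl fun i _ => by
        rw [RiskModel.integral_exp_smul_expErfc (r i) ((hSi i).trans hs)],
        ← hmodel.one_sub_integral_exp_walkSup_div hlam hμ hν hLT hρ hr ha hs0
          (hSlam.trans_le hs).ne', sub_eq_zero,
        ← RiskModel.integral_exp_mul_measureReal hMm
          (fun ω => RiskModel.walkSup_nonneg _) hs0, ← integral_complex_ofReal]
      refine integral_congr_ae (Eventually.of_forall fun u => ?_)
      simp only [Complex.real_smul, hψ]
      push_cast
      rfl
    have hae := RiskModel.ae_eq_zero_of_integral_exp_neg_nat_mul (hhint S le_rfl) fun n => by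
      have := hhzero (S + n) (by linarith [Nat.cast_nonneg (α := ℝ) n])
      rw [← this]
      refine integral_congr_ae (Eventually.of_forall fun u => ?_)
      simp only
      rw [smul_smul, ← Real.exp_nat_mul, ← Real.exp_add]
      congr 2
      ring
    have hcont : ∀ u, ContinuousWithinAt h (Set.Ici u) u := by
      intro u
      have h1 : ContinuousWithinAt (fun u => (ψ u : ℂ)) (Set.Ici u) u :=
        Complex.continuous_ofReal.continuousAt.comp_continuousWithinAt
          (RiskModel.continuousWithinAt_measureReal_lt hMm u)
      have h2 : Continuous fun u => c * ∑ i, a i / r i * RiskModel.expErfc (r i) u :=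
        continuous_const.mul (continuous_finsetSum _ fun i _ =>
          continuous_const.mul (RiskModel.continuous_expErfc (r i)))
      exact h1.sub h2.continuousWithinAt
    have hfin := RiskModel.eq_zero_of_ae_eq_zero_of_right_continuous
      (hae.mono fun u hu hu0 => (smul_eq_zero.1 (hu hu0)).resolve_left (Real.exp_pos _).ne')
      hcont hu
    rw [hψr]
    exact sub_eq_zero.1 hfin
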